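/- Let $m,n\ge 0$ be integers, let $K$ be a field extension of $\mathbb{C}$ and let $q,v_1,\dots,v_m\in K$. Assume that one of the following two conditions holds. (A) (Semisimple parameters.) $q\ne 0$; $1+q^2+\dots+q^{2N}\neq 0$ for all $0\le N<n$; $q^{2i}v_j\neq v_k$ for all $j\neq k$ and all integers $i$ with $-n<i<n$; $v_j\neq 0$ for all $j$; and, if $n\ge 2$, $q^2\neq 1$. (B) (Generic parameters.) $q,v_1,\dots,v_m$ are algebraically independent over $\mathbb{C}$ (for example, $K=\mathbb{C}(q,v_1,\dots,v_m)$ with $q,v_1,\dots,v_m$ indeterminates). The cyclotomic Hecke algebra $H(m,1,n)$ is the associative unital $K$-algebra generated by $\tau,\sigma_1,\dots,\sigma_{n-1}$ (with no generators, i.e. $H(m,1,0)=K$, for $n=0$) subject to the relations $\sigma_i\sigma_{i+1}\sigma_i=\sigma_{i+1}\sigma_i\sigma_{i+1}$; $\sigma_i\sigma_j=\sigma_j\sigma_i$ for $|i-j|>1$; $\tau\sigma_1\tau\sigma_1=\sigma_1\tau\sigma_1\tau$; $\tau\sigma_i=\sigma_i\tau$ for $i>1$; $\sigma_i^2=(q-q^{-1})\sigma_i+1$;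 and $(\tau-v_1)\cdots(\tau-v_m)=0$. An $m$-partition of $n$ is an $m$-tuple $\lambda=(\lambda_1,\dots,\lambda_m)$ of Young diagrams with $n$ nodes in total. A standard $m$-tableau $X$ of shape $\lambda$ is a bijective filling of the nodes of $\lambda$ by $1,\dots,n$ such that in each diagram the numbers increase along rows (to the right) and down columns. Denote by $c(X|i)=v_kq^{2(s-r)}$ the content of the node of $X$ containing $i$, where this node lies in row $r$ and column $s$ of the $k$-th diagram. Let $V_\lambda$ be the $K$-vector space with basis the standard $m$-tableaux of shape $\lambda$. For a standard $m$-tableau $X$ let $Xs_i$ be the filling obtained from $X$ by exchanging $i$ and $i+1$, interpreted as the vector $0\in V_\lambda$ if it is not standard. Then $c(X|i)\neq c(X|i+1)$ for every standard $m$-tableau $X$ with $n$ nodes and every $1\le i<n$, the formulas $$\tau X=c(X|1)\,X,\qquad \sigma_iX=-(q-q^{-1})\frac{c(X|i+1)}{c(X|i)-c(X|i+1)}\,X+\frac{q\,c(X|i+1)-q^{-1}c(X|i)}{c(X|i+1)-c(X|i)}\,Xs_i$$ define a representation of $H(m,1,n)$ on $V_\lambda$ for every $m$-partition $\lambda$ of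 $n$, and the following hold. 1. The representations $V_\lambda$ are irreducible and pairwise non-isomorphic. 2. $H(m,1,n)$ is finite-dimensional over $K$, and $\sum_{\lambda}(\dim_K V_\lambda)^2=\dim_K H(m,1,n)=n!\,m^n$, the sum being over all $m$-partitions $\lambda$ of $n$. 3. Every irreducible representation of $H(m,1,n)$ is isomorphic to some $V_\lambda$, and the algebra $H(m,1,n)$ is semisimple. -/

import Mathlib

namespace CyclotomicHecke

/-! ### The cyclotomic Hecke algebra `H(m,1,n)` -/

/-- The generators of `H(m,1,n)`: `τ` (present once `n ≥ 1`) and `σ₁, …, σ_{n-1}`.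
`sigma i` stands for `σ_{i+1}`, so `i + 1` runs over `1, …, n - 1`. -/
inductive Gen (n : ℕ) : Type
  | tau (h : 0 < n) : Gen n
  | sigma (i : ℕ) (h : i + 1 < n) : Gen n

section Algebra

variable {K : Type*} [Field K] {m : ℕ}

/-- `τ` in the free algebra. -/
abbrev freeTau (K : Type*) [Field K] {n : ℕ} (h : 0 < n) : FreeAlgebra K (Gen n) :=
  FreeAlgebra.ι K (Gen.tau h)

/-- `σ_{i+1}` in the free algebra. -/
abbrev freeSigma (K : Type*) [Field K] {n : ℕ} (i : ℕ) (h : i + 1 < n) :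
    FreeAlgebra K (Gen n) :=
  FreeAlgebra.ι K (Gen.sigma i h)

/-- The defining relations of `H(m,1,n)` with parameters `q` and `v₁, …, v_m`. -/
inductive Rel (q : K) (v : Fin m → K) (n : ℕ) :
    FreeAlgebra K (Gen n) → FreeAlgebra K (Gen n) → Prop
  | braid (i : ℕ) (h : i + 2 < n) :
      Rel q v n
        (freeSigma K i (by omega) * freeSigma K (i + 1) h * freeSigma K i (by omega))
        (freeSigma K (i + 1) h * freeSigma K i (by omega) * freeSigma K (i + 1) h)
  | comm (i j : ℕ) (hij : i + 1 < j) (h : j + 1 < n) :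
      Rel q v n
        (freeSigma K i (by omega) * freeSigma K j h)
        (freeSigma K j h * freeSigma K i (by omega))
  | tau_braid (h : 1 < n) :
      Rel q v n
        (freeTau K (by omega) * freeSigma K 0 h * freeTau K (by omega) * freeSigma K 0 h)
        (freeSigma K 0 h * freeTau K (by omega) * freeSigma K 0 h * freeTau K (by omega))
  | tau_comm (i : ℕ) (hi : 0 < i) (h : i + 1 < n) :
      Rel q v n
        (freeTau K (by omega) * freeSigma K i h)
        (freeSigma K i h * freeTau K (by omega))
  | quadratic (i : ℕ) (h : i + 1 < n) :
      Rel q v n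
        (freeSigma K i h ^ 2)
        ((q - q⁻¹) • freeSigma K i h + 1)
  | cyclotomic (h : 0 < n) :
      Rel q v n
        (List.ofFn fun j : Fin m => freeTau K h - algebraMap K (FreeAlgebra K (Gen n)) (v j)).prod
        0

/-- The cyclotomic Hecke algebra `H(m,1,n)` over `K` with parameters `q`, `v₁, …, v_m`. -/
abbrev HeckeAlgebra (q : K) (v : Fin m → K) (n : ℕ) : Type _ :=
  RingQuot (Rel q v n)

/-- The generator `τ` of `H(m,1,n)`. -/
noncomputable def tau (q : K) (v : Fin m → K) {n : ℕ} (h : 0 < n) : HeckeAlgebra q v n :=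
  RingQuot.mkAlgHom K (Rel q v n) (freeTau K h)

/-- The generator `σ_{i+1}` of `H(m,1,n)`. -/
noncomputable def sigma (q : K) (v : Fin m → K) {n : ℕ} (i : ℕ) (h : i + 1 < n) :
    HeckeAlgebra q v n :=
  RingQuot.mkAlgHom K (Rel q v n) (freeSigma K i h)

/-- The semisimplicity restrictions on the parameters: `q` is invertible,
`1 + q² + ⋯ + q^{2N} ≠ 0` for `N < n`, `q^{2i} v_j ≠ v_k` for `j ≠ k` and `-n < i < n`, and
`v_j ≠ 0`.  If `σ₁` is present, `q² ≠ 1` is needed for the denominators in the action of the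
`σ_i` on tableaux to be nonzero. -/
structure SemisimpleParameters (q : K) (v : Fin m → K) (n : ℕ) : Prop where
  q_ne_zero : q ≠ 0
  q_sq_ne_one : 2 ≤ n → q ^ 2 ≠ 1
  qsum_ne_zero : ∀ N : ℕ, N < n → ∑ i ∈ Finset.range (N + 1), q ^ (2 * i) ≠ 0
  separated : ∀ (i : ℤ) (j k : Fin m), j ≠ k → -(n : ℤ) < i → i < n →
    q ^ (2 * i) * v j - v k ≠ 0
  v_ne_zero : ∀ j, v j ≠ 0

/-- Generic parameters: `q, v₁, …, v_m` are indeterminates over `ℂ`, i.e. algebraically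
independent elements of the extension `K` of `ℂ`. -/
def GenericParameters [Algebra ℂ K] (q : K) (v : Fin m → K) : Prop :=
  AlgebraicIndependent ℂ (fun o : Option (Fin m) => o.elim q v)

end Algebra

/-! ### Young `m`-diagrams and standard `m`-tableaux -/

/-- `m`-partitions of length `n`. -/
@[ext]
structure MultiPartition (m n : ℕ) : Type where
  diagram : Fin m → YoungDiagram
  sum_card : ∑ k, (diagram k).card = n

theorem YoungDiagram_cells_subset (μ : YoungDiagram) :
    μ.cells ⊆ Finset.range μ.card ×ˢ Finset.range μ.card := by
  rintro ⟨i, j⟩ h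
  have hmem : (i, j) ∈ μ := h
  have h1 : (Finset.range (i + 1)).image (fun a => (a, j)) ⊆ μ.cells := by
    intro x hx
    obtain ⟨a, ha, rfl⟩ := Finset.mem_image.1 hx
    exact μ.up_left_mem (Nat.lt_succ_iff.1 (Finset.mem_range.1 ha)) le_rfl hmem
  have h2 : (Finset.range (j + 1)).image (fun a => (i, a)) ⊆ μ.cells := by
    intro x hx
    obtain ⟨a, ha, rfl⟩ := Finset.mem_image.1 hx
    exact μ.up_left_mem le_rfl (Nat.lt_succ_iff.1 (Finset.mem_range.1 ha)) hmem
  have c1 := Finset.card_le_card h1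
  have c2 := Finset.card_le_card h2
  rw [Finset.card_image_of_injective _ (fun a b hab => (Prod.ext_iff.1 hab).1),
    Finset.card_range] at c1
  rw [Finset.card_image_of_injective _ (fun a b hab => (Prod.ext_iff.1 hab).2),
    Finset.card_range] at c2
  exact Finset.mem_product.2 ⟨Finset.mem_range.2 c1, Finset.mem_range.2 c2⟩

instance instFiniteMultiPartition (m n : ℕ) : Finite (MultiPartition m n) := by
  let f : MultiPartition m n →
      (Fin m → {s : Finset (ℕ × ℕ) // s ∈ (Finset.range n ×ˢ Finset.range n).powerset}) :=
    fun lam k => ⟨(lam.diagram k).cells, by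
      have hk : (lam.diagram k).card ≤ n := by
        refine le_of_le_of_eq ?_ lam.sum_card
        exact Finset.single_le_sum (f := fun k => (lam.diagram k).card)
          (fun _ _ => Nat.zero_le _) (Finset.mem_univ k)
      refine Finset.mem_powerset.2 ((YoungDiagram_cells_subset _).trans ?_)
      exact Finset.product_subset_product (Finset.range_subset_range.2 hk)
        (Finset.range_subset_range.2 hk)⟩
  refine Finite.of_injective f fun a b hab => MultiPartition.ext (funext fun k => ?_)
  exact YoungDiagram.ext (congrArg Subtype.val (congrFun hab k))

noncomputable instance instFintypeMultiPartition (m n : ℕ) : Fintype (MultiPartition m n) :=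
  Fintype.ofFinite _

variable {m n : ℕ}

/-- The nodes of an `m`-partition: `⟨k, (r, s)⟩` is the node in line `r` and column `s` of the
`k`-th diagram. -/
abbrev Node (lam : MultiPartition m n) : Type :=
  Σ k : Fin m, {c : ℕ × ℕ // c ∈ lam.diagram k}

/-- A filling of the nodes by `1, …, n` (here `Fin n`: the element `i` is the number `i + 1`) is
standard if the entries ascend along the rows and down the columns of every diagram. -/
def IsStandard (lam : MultiPartition m n) (e : Node lam ≃ Fin n) : Prop :=
  (∀ (k : Fin m) (r s s' : ℕ) (h : (r, s) ∈ lam.diagram k) (h' : (r, s') ∈ lam.diagram k),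
    s < s' → e ⟨k, (r, s), h⟩ < e ⟨k, (r, s'), h'⟩) ∧
  (∀ (k : Fin m) (r r' s : ℕ) (h : (r, s) ∈ lam.diagram k) (h' : (r', s) ∈ lam.diagram k),
    r < r' → e ⟨k, (r, s), h⟩ < e ⟨k, (r', s), h'⟩)

/-- Standard `m`-tableaux of shape `lam`. -/
@[ext]
structure StandardTableau (lam : MultiPartition m n) : Type where
  entry : Node lam ≃ Fin n
  standard : IsStandard lam entry

/-! ### The representation on standard tableaux -/

section Action

variable {K : Type*} [Field K]

/-- The content `v_k q^{2(s-r)}` of a node in line `r` and column `s` of the `k`-th diagram. -/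
def nodeContent (q : K) (v : Fin m → K) {lam : MultiPartition m n} (x : Node lam) : K :=
  v x.1 * q ^ (2 * ((x.2.1.2 : ℤ) - (x.2.1.1 : ℤ)))

/-- `c(X | i + 1)`: the content of the node of `X` carrying the number `i + 1`. -/
def content (q : K) (v : Fin m → K) {lam : MultiPartition m n} (X : StandardTableau lam)
    (i : Fin n) : K :=
  nodeContent q v (X.entry.symm i)

/-- The space `V_lam` with basis the standard `m`-tableaux of shape `lam`. -/
abbrev TableauSpace (K : Type*) [Field K] (lam : MultiPartition m n) : Type _ :=
  StandardTableau lam →₀ K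

open Classical in
/-- The vector `X s_{i+1}`: exchange the numbers `i + 1` and `i + 2` in `X`; the result is `0` if
the new filling is not standard. -/
noncomputable def swapVector (K : Type*) [Field K] {lam : MultiPartition m n}
    (X : StandardTableau lam) (i : ℕ) (h : i + 1 < n) : TableauSpace K lam :=
  if hs : IsStandard lam (X.entry.trans (Equiv.swap ⟨i, by omega⟩ ⟨i + 1, h⟩)) then
    Finsupp.single ⟨X.entry.trans (Equiv.swap ⟨i, by omega⟩ ⟨i + 1, h⟩), hs⟩ 1
  else 0

/-- The operator by which `τ` acts on `V_lam`: `X ↦ c(X|1) X`. -/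
noncomputable def tauOp (q : K) (v : Fin m → K) (lam : MultiPartition m n) (h : 0 < n) :
    Module.End K (TableauSpace K lam) :=
  Finsupp.linearCombination K fun X : StandardTableau lam =>
    content q v X ⟨0, h⟩ • Finsupp.single X (1 : K)

/-- The operator by which `σ_i` acts on `V_lam`:
`X ↦ - (q - q⁻¹) c(X|i+1) / (c(X|i) - c(X|i+1)) X
  + (q c(X|i+1) - q⁻¹ c(X|i)) / (c(X|i+1) - c(X|i)) X s_i`
(with indices shifted by one). -/
noncomputable def sigmaOp (q : K) (v : Fin m → K) (lam : MultiPartition m n) (i : ℕ)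
    (h : i + 1 < n) : Module.End K (TableauSpace K lam) :=
  Finsupp.linearCombination K fun X : StandardTableau lam =>
    (-((q - q⁻¹) * (content q v X ⟨i + 1, h⟩ /
        (content q v X ⟨i, by omega⟩ - content q v X ⟨i + 1, h⟩)))) • Finsupp.single X (1 : K)
      + ((q * content q v X ⟨i + 1, h⟩ - q⁻¹ * content q v X ⟨i, by omega⟩) /
        (content q v X ⟨i + 1, h⟩ - content q v X ⟨i, by omega⟩)) • swapVector K X i h

end Action

/-! ### Representations of an algebra as modules -/

section AsModule

variable {K A V : Type*} [Field K] [Ring A] [Algebra K A] [AddCommGroup V] [Module K V]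

/-- The space of a representation `ρ : A → End V`, as an `A`-module with `a • x = ρ a x`. -/
def AsModule (_ρ : A →ₐ[K] Module.End K V) : Type _ := V

instance (ρ : A →ₐ[K] Module.End K V) : AddCommGroup (AsModule ρ) :=
  inferInstanceAs (AddCommGroup V)

instance (ρ : A →ₐ[K] Module.End K V) : Module K (AsModule ρ) :=
  inferInstanceAs (Module K V)

instance (ρ : A →ₐ[K] Module.End K V) : Module A (AsModule ρ) :=
  Module.compHom V ρ.toRingHom

end AsModule

end CyclotomicHecke

open CyclotomicHecke

/-! All the actions on tableaux together give a homomorphism from H(m,1,n) to the product of the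
matrix algebras End V_λ. Every claim follows once it is an isomorphism, and this is a squeeze of
dimensions: surjectivity gives Σ (dim V_λ)² ≤ dim H, a spanning set gives dim H ≤ n! mⁿ, and a count
of tableaux gives n! mⁿ ≤ Σ (dim V_λ)².

Upper bound. As a right module over the image of H(m,1,n), the algebra H(m,1,n+1) is spanned by the
(n+1)m elements σ_j⋯σ_1 τ^a σ_1⋯σ_n with j ≤ n and a < m: their span contains 1 and is stable under
left multiplication by the generators. The hard case is τ, where `tau_mul_sigma_mul_pow_mul_sigma`
moves τ past σ_1 τ^a σ_1.

Action. A tableau is recorded as the sequence of positions of its entries, so V_λ embeds in the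
space spanned by all sequences of nodes. The operators are defined there too, with the off-diagonal
coefficient set to 0 when the two contents differ by a factor q²; by `content_adjacent_iff` this
happens exactly when the exchange leaves the standard tableaux. The relations become rational
identities in at most three contents, and the denominators are nonzero because nearby entries have
different contents (`content_ne`).

Surjectivity. The Jucys–Murphy elements J_1 = τ, J_{i+1} = σ_i J_i σ_i act diagonally by contents.
The contents determine both shape and tableau (`pos_eq_of_content_eq`), so the image contains all
diagonal matrices. The off-diagonal coefficients of the σ_i join tableaux that differ by an
exchange, and exchanges connect all tableaux of a shape (`swap_induction`), so the image contains
all matrix units.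

Count. A lower set of nodes has m more addable than removable nodes (`card_addable`), and otherwise
adding and removing commute. This is the relation DU = UD + m of a differential poset; it multiplies
the sum of squares by m(n+1) when n grows by one. -/

namespace CyclotomicHecke

/-! ### A spanning set for `H(m,1,n+1)` over `H(m,1,n)` -/

section Spanning

variable {K A : Type*} [Field K] [Ring A] [Algebra K A]

/-- Elements `t, s 0, …, s (n-1)` of an algebra which satisfy the affine Hecke relations. -/
structure IsHeckeFamily (δ : K) (n : ℕ) (t : A) (s : ℕ → A) : Prop where
  braid : ∀ i, i + 1 < n → s i * s (i + 1) * s i = s (i + 1) * s i * s (i + 1)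
  comm : ∀ i j, i + 1 < j → j < n → s i * s j = s j * s i
  tau_braid : 0 < n → t * s 0 * t * s 0 = s 0 * t * s 0 * t
  tau_comm : ∀ i, 0 < i → i < n → t * s i = s i * t
  quadratic : ∀ i, i < n → s i ^ 2 = δ • s i + 1

/-- `s 0 * s 1 * ⋯ * s (k-1)`. -/
def ascProd (s : ℕ → A) : ℕ → A
  | 0 => 1
  | k + 1 => ascProd s k * s k

/-- `s (k-1) * ⋯ * s 1 * s 0`. -/
def descProd (s : ℕ → A) : ℕ → A
  | 0 => 1
  | k + 1 => s k * descProd s k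

theorem ascProd_succ_shift (s : ℕ → A) (k : ℕ) :
    ascProd s (k + 1) = s 0 * ascProd (fun i => s (i + 1)) k := by
  induction k with
  | zero => simp [ascProd]
  | succ k ih => rw [ascProd, ih, ascProd, mul_assoc]

theorem descProd_succ_shift (s : ℕ → A) (k : ℕ) :
    descProd s (k + 1) = descProd (fun i => s (i + 1)) k * s 0 := by
  induction k with
  | zero => simp [descProd]
  | succ k ih => rw [descProd, ih, descProd, mul_assoc]

theorem commute_ascProd {s : ℕ → A} {x : A} {k : ℕ} (h : ∀ i < k, Commute x (s i)) :
    Commute x (ascProd s k) := by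
  induction k with
  | zero => exact Commute.one_right x
  | succ k ih => exact (ih fun i hi => h i (by omega)).mul_right (h k (by omega))

theorem commute_descProd {s : ℕ → A} {x : A} {k : ℕ} (h : ∀ i < k, Commute x (s i)) :
    Commute x (descProd s k) := by
  induction k with
  | zero => exact Commute.one_right x
  | succ k ih => exact (h k (by omega)).mul_right (ih fun i hi => h i (by omega))

theorem descProd_mem {B : Subalgebra K A} {s : ℕ → A} {k : ℕ} (h : ∀ i < k, s i ∈ B) :
    descProd s k ∈ B := by
  induction k with
  | zero => exact B.one_mem
  | succ k ih => exact B.mul_mem (h k (by omega)) (ih fun i hi => h i (by omega))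

/-! ### Commutation rules for ascending and descending products -/

namespace IsHeckeFamily

variable {δ : K} {n : ℕ} {t : A} {s : ℕ → A}

/-- The braid relation applies at the factors `s i * s (i + 1)`; all other factors commute with what
passes them. The index drops by one, so the generator emerges in the smaller algebra. -/
theorem mul_ascProd (H : IsHeckeFamily δ n t s) {i k : ℕ} (hik : i + 1 < k) (hk : k ≤ n) :
    s (i + 1) * ascProd s k = ascProd s k * s i := by
  induction k, hik using Nat.le_induction with
  | base =>
    have h1 : Commute (s (i + 1)) (ascProd s i) :=
      commute_ascProd fun j hj => (H.comm j (i + 1) (by omega) (by omega)).symm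
    simp only [ascProd]
    rw [mul_assoc (ascProd s i), ← mul_assoc, h1.eq, mul_assoc, ← mul_assoc (s (i + 1)),
      ← H.braid i (by omega)]
    simp only [mul_assoc]
  | succ k hk' ih =>
    rw [ascProd, ← mul_assoc, ih (by omega), mul_assoc, H.comm i k (by omega) (by omega),
      mul_assoc]

theorem mul_descProd (H : IsHeckeFamily δ n t s) {i k : ℕ} (hik : i + 1 < k) (hk : k ≤ n) :
    s i * descProd s k = descProd s k * s (i + 1) := by
  induction k, hik using Nat.le_induction with
  | base =>
    have h1 : Commute (s (i + 1)) (descProd s i) :=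
      commute_descProd fun j hj => (H.comm j (i + 1) (by omega) (by omega)).symm
    simp only [descProd]
    rw [← mul_assoc, ← mul_assoc, H.braid i (by omega), mul_assoc, h1.eq]
    simp only [mul_assoc]
  | succ k hk' ih =>
    rw [descProd, ← mul_assoc, H.comm i k (by omega) (by omega), mul_assoc, ih (by omega),
      mul_assoc]

/-- Each factor passes the full ascending product by `mul_ascProd`, which undoes the shift of its
index. -/
theorem descProd_shift_mul_ascProd (H : IsHeckeFamily δ n t s) {j : ℕ} (hj : j < n) :
    descProd (fun i => s (i + 1)) j * ascProd s n = ascProd s n * descProd s j := by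
  induction j with
  | zero => simp [descProd]
  | succ j ih =>
    rw [descProd, mul_assoc, ih (by omega), ← mul_assoc, H.mul_ascProd hj le_rfl, mul_assoc,
      descProd]

/-- On the right, `t` either stands at the far end or only one factor `s 0` is left. This makes the
span of the coset elements stable under `t`. -/
theorem tau_mul_sigma_mul_pow_mul_sigma (H : IsHeckeFamily δ n t s) (hn : 0 < n) (a : ℕ) :
    t * s 0 * t ^ a * s 0 =
      s 0 * t ^ a * s 0 * t - δ • (t ^ a * s 0 * t) + δ • (t * s 0 * t ^ a) := by
  have hq : s 0 * s 0 = δ • s 0 + 1 := by rw [← sq, H.quadratic 0 hn]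
  induction a with
  | zero =>
    simp only [pow_zero, mul_one, one_mul, mul_assoc, hq]
    simp only [mul_add, add_mul, mul_one, one_mul, mul_smul_comm, smul_mul_assoc]
    abel
  | succ a ih =>
    -- J is the second Jucys–Murphy element and commutes with `t`. Replacing `s 0 * t` by `J * s 0 -
    -- δ • J` turns the case a + 1 into J times the case a, up to correction terms with factor δ.
    set J := s 0 * t * s 0 with hJ
    have hJt : Commute J t := by
      have := H.tau_braid hn
      simp only [Commute, SemiconjBy, hJ, ← mul_assoc, this]
    have hJs : J * s 0 = δ • J + s 0 * t := by
      rw [hJ, mul_assoc, hq, mul_add, mul_one, mul_smul_comm]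
    have hst : s 0 * t = J * s 0 - δ • J := by rw [hJs]; abel
    have e1 : t * s 0 * t ^ (a + 1) * s 0 =
        J * (t * s 0 * t ^ a * s 0 - δ • (t ^ (a + 1) * s 0)) := by
      calc t * s 0 * t ^ (a + 1) * s 0 = t * (s 0 * t) * (t ^ a * s 0) := by
            rw [pow_succ']; simp only [mul_assoc]
        _ = (t * J) * (s 0 * t ^ a * s 0 - δ • (t ^ a * s 0)) := by
            rw [hst]; simp only [mul_sub, sub_mul, mul_assoc, smul_mul_assoc, mul_smul_comm]
        _ = _ := by
            rw [← hJt.eq, pow_succ']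
            simp only [mul_sub, mul_assoc, mul_smul_comm]
    have e2 : s 0 * t ^ (a + 1) * s 0 * t =
        J * (s 0 * t ^ a * s 0 * t - δ • (t ^ a * s 0 * t)) := by
      calc s 0 * t ^ (a + 1) * s 0 * t = (s 0 * t) * (t ^ a * s 0 * t) := by
            rw [pow_succ']; simp only [mul_assoc]
        _ = _ := by
            rw [hst]; simp only [mul_sub, sub_mul, mul_assoc, smul_mul_assoc, mul_smul_comm]
    have key : ∀ b c : ℕ, J * (t ^ b * s 0 * t ^ c) =
        δ • (t ^ (b + c) * J) + t ^ b * s 0 * t ^ (c + 1) := by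
      intro b c
      rw [← mul_assoc, ← mul_assoc, (hJt.pow_right b).eq, mul_assoc (t ^ b), hJs, mul_add,
        add_mul, mul_smul_comm, smul_mul_assoc, mul_assoc (t ^ b) J, (hJt.pow_right c).eq,
        ← mul_assoc, ← pow_add, pow_succ' t c]
      simp only [mul_assoc]
    have k1 := key a 1
    have k2 := key 1 a
    have k3 := key (a + 1) 0
    simp only [pow_one, pow_zero, mul_one, zero_add] at k1 k2 k3
    rw [e1, ih, e2]
    simp only [mul_add, mul_sub, mul_smul_comm, k1, k2, k3]
    rw [add_comm 1 a]
    simp only [smul_add, add_zero]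
    abel

end IsHeckeFamily

/-- The elements `s_{j} ⋯ s_1 t^a s_1 ⋯ s_n` which generate the algebra as a right module. -/
def cosetElement (t : A) (s : ℕ → A) (n j a : ℕ) : A :=
  descProd s j * t ^ a * ascProd s n

/-- The right `B`-module generated by the elements `cosetElement t s n j a` with `j ≤ n` and
`a < m`. -/
def cosetSpan (t : A) (s : ℕ → A) (n m : ℕ) (B : Subalgebra K A) : Submodule K A :=
  Submodule.span K {x | ∃ j ≤ n, ∃ a < m, ∃ b ∈ B, x = cosetElement t s n j a * b}

/-- Division of X^a by p with remainder. -/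
theorem pow_mem_span_of_monic {t : A} {p : Polynomial K} (hp : p.Monic)
    (h0 : Polynomial.aeval t p = 0) (a : ℕ) :
    t ^ a ∈ Submodule.span K {x | ∃ i < p.natDegree, x = t ^ i} := by
  have h1 : Polynomial.aeval t (Polynomial.X ^ a %ₘ p) = t ^ a := by
    have h2 := congrArg (Polynomial.aeval t) (Polynomial.modByMonic_add_div (Polynomial.X ^ a) p)
    simpa [h0] using h2
  rw [← h1, Polynomial.aeval_eq_sum_range]
  refine Submodule.sum_mem _ fun i _ => ?_
  by_cases hi : i < p.natDegree
  · exact Submodule.smul_mem _ _ (Submodule.subset_span ⟨i, hi, rfl⟩)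
  · have : (Polynomial.X ^ a %ₘ p).coeff i = 0 := by
      apply Polynomial.coeff_eq_zero_of_degree_lt
      refine (Polynomial.degree_modByMonic_lt _ hp).trans_le ?_
      exact Polynomial.degree_le_of_natDegree_le (not_lt.1 hi)
    rw [this, zero_smul]
    exact Submodule.zero_mem _

/-! ### Stability of the coset span under the generators -/

section Closed

variable {δ : K} {n m : ℕ} {t : A} {s : ℕ → A} {B : Subalgebra K A}

theorem cosetSpan_mul_mem {x b : A} (hx : x ∈ cosetSpan t s n m B) (hb : b ∈ B) :
    x * b ∈ cosetSpan t s n m B := by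
  induction hx using Submodule.span_induction with
  | mem x h =>
    obtain ⟨j, hj, a, ha, c, hc, rfl⟩ := h
    exact Submodule.subset_span ⟨j, hj, a, ha, c * b, B.mul_mem hc hb, mul_assoc _ _ _⟩
  | zero => rw [zero_mul]; exact Submodule.zero_mem _
  | add x y _ _ hx hy => rw [add_mul]; exact Submodule.add_mem _ hx hy
  | smul c x _ hx => rw [smul_mul_assoc]; exact Submodule.smul_mem _ _ hx

/-- The exponent `a` is unrestricted here: the equation satisfied by `t` reduces it below `m`. Later
steps may therefore raise powers of `t` freely. -/
theorem cosetElement_mem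
    (hpow : ∀ a, t ^ a ∈ Submodule.span K {x | ∃ i < m, x = t ^ i}) {j : ℕ} (hj : j ≤ n)
    (a : ℕ) : cosetElement t s n j a ∈ cosetSpan t s n m B := by
  have : ∀ x ∈ Submodule.span K {x | ∃ i < m, x = t ^ i},
      descProd s j * x * ascProd s n ∈ cosetSpan t s n m B := by
    intro x hx
    induction hx using Submodule.span_induction with
    | mem x h =>
      obtain ⟨i, hi, rfl⟩ := h
      exact Submodule.subset_span ⟨j, hj, i, hi, 1, B.one_mem, (mul_one _).symm⟩
    | zero => simp
    | add x y _ _ hx hy => rw [mul_add, add_mul]; exact Submodule.add_mem _ hx hy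
    | smul c x _ hx =>
      rw [mul_smul_comm, smul_mul_assoc]; exact Submodule.smul_mem _ _ hx
  exact this _ (hpow a)

theorem mul_mem_cosetSpan {g : A}
    (hg : ∀ j ≤ n, ∀ a < m, g * cosetElement t s n j a ∈ cosetSpan t s n m B) {x : A}
    (hx : x ∈ cosetSpan t s n m B) : g * x ∈ cosetSpan t s n m B := by
  induction hx using Submodule.span_induction with
  | mem x h =>
    obtain ⟨j, hj, a, ha, c, hc, rfl⟩ := h
    rw [← mul_assoc]
    exact cosetSpan_mul_mem (hg j hj a ha) hc
  | zero => rw [mul_zero]; exact Submodule.zero_mem _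
  | add x y _ _ hx hy => rw [mul_add]; exact Submodule.add_mem _ hx hy
  | smul c x _ hx => rw [mul_smul_comm]; exact Submodule.smul_mem _ _ hx

/-- According to the position of i relative to j, the factor `s i` passes through and emerges in B
(i + 1 < j or i > j), meets the leading factor and is reduced by the quadratic relation (i + 1 = j),
or lengthens the descending product (i = j). -/
theorem IsHeckeFamily.sigma_mul_mem_cosetSpan (H : IsHeckeFamily δ n t s)
    (hpow : ∀ a, t ^ a ∈ Submodule.span K {x | ∃ i < m, x = t ^ i})
    (hB : ∀ i, i + 1 < n → s i ∈ B) {i : ℕ} (hi : i < n) {x : A}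
    (hx : x ∈ cosetSpan t s n m B) : s i * x ∈ cosetSpan t s n m B := by
  refine mul_mem_cosetSpan (fun j hj a _ => ?_) hx
  have hu : ∀ j ≤ n, ∀ a, cosetElement t s n j a ∈ cosetSpan t s n m B :=
    fun j hj a => cosetElement_mem hpow hj a
  have hpass : ∀ i, i + 1 < n → s (i + 1) * (t ^ a * ascProd s n) =
      t ^ a * ascProd s n * s i := by
    intro i hi
    have h1 : Commute (s (i + 1)) (t ^ a) :=
      Commute.pow_right (H.tau_comm (i + 1) (by omega) hi).symm a
    rw [← mul_assoc, h1.eq, mul_assoc, H.mul_ascProd hi le_rfl, mul_assoc]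
  rcases lt_trichotomy i j with hij | rfl | hij
  · rcases Nat.lt_or_ge (i + 1) j with h | h
    · have : s i * cosetElement t s n j a = cosetElement t s n j a * s i := by
        rw [cosetElement, mul_assoc, ← mul_assoc, H.mul_descProd h hj, mul_assoc,
          hpass i (by omega), mul_assoc, mul_assoc, mul_assoc]
      rw [this]
      exact cosetSpan_mul_mem (hu j hj a) (hB i (by omega))
    · obtain rfl : j = i + 1 := by omega
      have : s i * cosetElement t s n (i + 1) a =
          δ • cosetElement t s n (i + 1) a + cosetElement t s n i a := by
        simp only [cosetElement, descProd, mul_assoc]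
        rw [← mul_assoc, ← sq, H.quadratic i hi, add_mul, one_mul, smul_mul_assoc]
      rw [this]
      exact Submodule.add_mem _ (Submodule.smul_mem _ _ (hu _ hj a)) (hu _ (by omega) a)
  · have : s i * cosetElement t s n i a = cosetElement t s n (i + 1) a := by
      simp only [cosetElement, descProd, mul_assoc]
    rw [this]
    exact hu _ hi a
  · obtain ⟨i, rfl⟩ : ∃ l, i = l + 1 := ⟨i - 1, by omega⟩
    have h1 : Commute (s (i + 1)) (descProd s j) :=
      commute_descProd fun l hl => (H.comm l (i + 1) (by omega) hi).symm
    have : s (i + 1) * cosetElement t s n j a = cosetElement t s n j a * s i := by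
      rw [cosetElement, mul_assoc, ← mul_assoc, h1.eq, mul_assoc, hpass i hi]
      simp only [mul_assoc]
    rw [this]
    exact cosetSpan_mul_mem (hu j hj a) (hB i hi)

/-- All `s i` with i > 0 commute with `t`, so only the inner block `s 0 * t ^ a * s 0` matters. The
correction terms contain a single `s 0`; there the remaining descending product moves to the right,
into B. -/
theorem IsHeckeFamily.tau_mul_mem_cosetSpan (H : IsHeckeFamily δ n t s)
    (hpow : ∀ a, t ^ a ∈ Submodule.span K {x | ∃ i < m, x = t ^ i})
    (hBt : 0 < n → t ∈ B) (hB : ∀ i, i + 1 < n → s i ∈ B) {x : A}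
    (hx : x ∈ cosetSpan t s n m B) : t * x ∈ cosetSpan t s n m B := by
  refine mul_mem_cosetSpan (fun j hj a _ => ?_) hx
  have hu : ∀ j ≤ n, ∀ a, cosetElement t s n j a ∈ cosetSpan t s n m B :=
    fun j hj a => cosetElement_mem hpow hj a
  rcases j with - | j
  · have : t * cosetElement t s n 0 a = cosetElement t s n 0 (a + 1) := by
      simp only [cosetElement, descProd, one_mul, pow_succ', mul_assoc]
    rw [this]
    exact hu 0 (by omega) _
  · have hn : 0 < n := by omega
    obtain ⟨N, rfl⟩ : ∃ N, n = N + 1 := ⟨n - 1, by omega⟩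
    set d := descProd (fun i => s (i + 1)) j with hd
    set c := ascProd (fun i => s (i + 1)) N with hc
    have hdc : ∀ k, Commute (t ^ k) d := fun k => Commute.pow_left (commute_descProd
      fun i hi => H.tau_comm (i + 1) (by omega) (by omega)) k
    have hcc : ∀ k, Commute (t ^ k) c := fun k => Commute.pow_left (commute_ascProd
      fun i hi => H.tau_comm (i + 1) (by omega) (by omega)) k
    have hasc : ascProd s (N + 1) = s 0 * c := ascProd_succ_shift s N
    have hdesc : descProd s (j + 1) = d * s 0 := descProd_succ_shift s j
    have hdd : d * (s 0 * c) = ascProd s (N + 1) * descProd s j := by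
      rw [← hasc]; exact H.descProd_shift_mul_ascProd (by omega)
    have hterm : ∀ k l : ℕ, d * (t ^ k * s 0 * t ^ l) * c =
        cosetElement t s (N + 1) 0 k * (descProd s j * t ^ l) := by
      intro k l
      calc d * (t ^ k * s 0 * t ^ l) * c = (d * t ^ k) * s 0 * (t ^ l * c) := by
            simp only [mul_assoc]
        _ = t ^ k * (d * (s 0 * c)) * t ^ l := by
            rw [← (hdc k).eq, (hcc l).eq]; simp only [mul_assoc]
        _ = _ := by rw [hdd]; simp only [cosetElement, descProd, one_mul, mul_assoc]
    have hd1 : t * d = d * t := by simpa using (hdc 1).eq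
    have hc1 : t * c = c * t := by simpa using (hcc 1).eq
    have main : t * cosetElement t s (N + 1) (j + 1) a =
        cosetElement t s (N + 1) (j + 1) a * t
          - δ • (cosetElement t s (N + 1) 0 a * (descProd s j * t))
          + δ • (cosetElement t s (N + 1) 0 1 * (descProd s j * t ^ a)) := by
      have h1 := hterm a 1
      have h2 := hterm 1 a
      simp only [pow_one] at h1 h2
      calc t * cosetElement t s (N + 1) (j + 1) a
          = (t * d) * (s 0 * t ^ a * s 0) * c := by
            rw [cosetElement, hasc, hdesc]; simp only [mul_assoc]
        _ = d * (t * s 0 * t ^ a * s 0) * c := by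
            rw [hd1]; simp only [mul_assoc]
        _ = _ := by
            rw [H.tau_mul_sigma_mul_pow_mul_sigma hn, ← h1, ← h2, cosetElement, hasc, hdesc]
            simp only [mul_add, mul_sub, add_mul, sub_mul, mul_smul_comm, smul_mul_assoc,
              mul_assoc, hc1]
    have hdB : descProd s j ∈ B := descProd_mem fun i hi => hB i (by omega)
    rw [main]
    refine Submodule.add_mem _ (Submodule.sub_mem _ ?_ ?_) ?_
    · exact cosetSpan_mul_mem (hu _ hj a) (hBt hn)
    · exact Submodule.smul_mem _ _ (cosetSpan_mul_mem (hu 0 (by omega) a)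
        (B.mul_mem hdB (hBt hn)))
    · exact Submodule.smul_mem _ _ (cosetSpan_mul_mem (hu 0 (by omega) 1)
        (B.mul_mem hdB (B.pow_mem (hBt hn) a)))

/-- The coset element with j = a = 0 is the full ascending product, a product of invertible elements
whose inverses preserve the span. -/
theorem IsHeckeFamily.one_mem_cosetSpan (H : IsHeckeFamily δ n t s)
    (hpow : ∀ a, t ^ a ∈ Submodule.span K {x | ∃ i < m, x = t ^ i})
    (hB : ∀ i, i + 1 < n → s i ∈ B) : (1 : A) ∈ cosetSpan t s n m B := by
  have hinv : ∀ i < n, ∀ x, s i * x ∈ cosetSpan t s n m B → x ∈ cosetSpan t s n m B := by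
    intro i hi x hx
    -- By the quadratic relation the inverse of `s i` is `s i - δ`.
    have h1 : x = s i * (s i * x) - δ • (s i * x) := by
      rw [← mul_assoc, ← sq, H.quadratic i hi, add_mul, one_mul, smul_mul_assoc]
      abel
    rw [h1]
    exact Submodule.sub_mem _ (H.sigma_mul_mem_cosetSpan hpow hB hi hx)
      (Submodule.smul_mem _ _ hx)
  have hasc : ∀ k ≤ n, ∀ x, ascProd s k * x ∈ cosetSpan t s n m B →
      x ∈ cosetSpan t s n m B := by
    intro k
    induction k with
    | zero => intro _ x hx; simpa [ascProd] using hx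
    | succ k ih =>
      intro hk x hx
      rw [ascProd, mul_assoc] at hx
      exact hinv k hk x (ih (by omega) _ hx)
  refine hasc n le_rfl 1 ?_
  have h := cosetElement_mem (B := B) (s := s) hpow (Nat.zero_le n) 0
  simpa [cosetElement, descProd] using h

end Closed
end Spanning

/-! ### The dimension of `H(m,1,n)` is at most `n! mⁿ` -/

section DimensionBound

variable {K : Type*} [Field K] {m : ℕ} (q : K) (v : Fin m → K)

/-- Every element of the Hecke algebra is obtained from the generators. -/
theorem adjoin_generators_eq_top (n : ℕ) :
    Algebra.adjoin K (Set.range fun g : Gen n =>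
      RingQuot.mkAlgHom K (Rel q v n) (FreeAlgebra.ι K g)) = ⊤ := by
  have h : (Set.range fun g : Gen n => RingQuot.mkAlgHom K (Rel q v n) (FreeAlgebra.ι K g)) =
      RingQuot.mkAlgHom K (Rel q v n) '' Set.range (FreeAlgebra.ι K) := by
    rw [← Set.range_comp]; rfl
  rw [h, ← AlgHom.map_adjoin, FreeAlgebra.adjoin_range_ι, Algebra.map_top]
  exact AlgHom.range_eq_top _ |>.2 (RingQuot.mkAlgHom_surjective K _)

/-- A subspace which contains `1` and is closed under left multiplication by the generators is
the whole algebra. -/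
theorem eq_top_of_generators_mul_mem {n : ℕ} {U : Submodule K (HeckeAlgebra q v n)}
    (h1 : 1 ∈ U) (htau : ∀ (h : 0 < n), ∀ x ∈ U, tau q v h * x ∈ U)
    (hsigma : ∀ (i : ℕ) (h : i + 1 < n), ∀ x ∈ U, sigma q v i h * x ∈ U) : U = ⊤ := by
  have key : ∀ y ∈ Algebra.adjoin K (Set.range fun g : Gen n =>
      RingQuot.mkAlgHom K (Rel q v n) (FreeAlgebra.ι K g)), ∀ x ∈ U, y * x ∈ U := by
    intro y hy
    induction hy using Algebra.adjoin_induction with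
    | mem y hy =>
      obtain ⟨g, rfl⟩ := hy
      cases g with
      | tau h => exact htau h
      | sigma i h => exact hsigma i h
    | algebraMap r =>
      intro x hx
      rw [← Algebra.smul_def]
      exact U.smul_mem r hx
    | add y z _ _ hy hz =>
      intro x hx
      rw [add_mul]
      exact U.add_mem (hy x hx) (hz x hx)
    | mul y z _ _ hy hz =>
      intro x hx
      rw [mul_assoc]
      exact hy _ (hz x hx)
  refine Submodule.eq_top_iff'.2 fun y => ?_
  rw [← mul_one y]
  exact key y (by rw [adjoin_generators_eq_top]; trivial) 1 h1

/-- The elements `σ_{i+1}`, extended by `0` to all natural numbers `i`. -/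
noncomputable def sigmaFamily (n i : ℕ) : HeckeAlgebra q v n :=
  if h : i + 1 < n then sigma q v i h else 0

variable {q v} in
theorem sigmaFamily_of_lt {n i : ℕ} (h : i + 1 < n) : sigmaFamily q v n i = sigma q v i h :=
  dif_pos h

variable {q v} in
theorem mk_rel {n : ℕ} {x y : FreeAlgebra K (Gen n)} (h : Rel q v n x y) :
    RingQuot.mkAlgHom K (Rel q v n) x = RingQuot.mkAlgHom K (Rel q v n) y :=
  RingQuot.mkAlgHom_rel K h

theorem isHeckeFamily (n : ℕ) :
    IsHeckeFamily (q - q⁻¹) n (tau q v (n := n + 1) n.succ_pos) (sigmaFamily q v (n + 1)) where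
  braid i h := by
    rw [sigmaFamily_of_lt (by omega), sigmaFamily_of_lt (by omega)]
    simpa only [tau, sigma, map_mul] using
      mk_rel (Rel.braid (q := q) (v := v) (n := n + 1) i (by omega))
  comm i j hij h := by
    rw [sigmaFamily_of_lt (by omega), sigmaFamily_of_lt (by omega)]
    simpa only [tau, sigma, map_mul] using
      mk_rel (Rel.comm (q := q) (v := v) (n := n + 1) i j hij (by omega))
  tau_braid h := by
    rw [sigmaFamily_of_lt (by omega)]
    simpa only [tau, sigma, map_mul] using
      mk_rel (Rel.tau_braid (q := q) (v := v) (n := n + 1) (by omega))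
  tau_comm i hi h := by
    rw [sigmaFamily_of_lt (by omega)]
    simpa only [tau, sigma, map_mul] using
      mk_rel (Rel.tau_comm (q := q) (v := v) (n := n + 1) i hi (by omega))
  quadratic i h := by
    rw [sigmaFamily_of_lt (by omega)]
    simpa only [sigma, map_pow, map_add, map_smul, map_one] using
      mk_rel (Rel.quadratic (q := q) (v := v) (n := n + 1) i (by omega))

/-- The product over `List.ofFn` of the factors `x - v j`, as the value at `x` of a polynomial. -/
theorem list_prod_sub_eq_aeval {A : Type*} [Ring A] [Algebra K A] (x : A) :
    (List.ofFn fun j : Fin m => x - algebraMap K A (v j)).prod =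
      Polynomial.aeval x (∏ j, (Polynomial.X - Polynomial.C (v j))) := by
  rw [← List.prod_ofFn, map_list_prod, List.map_ofFn]
  congr 2
  funext j
  simp

theorem aeval_tau_eq_zero {n : ℕ} (h : 0 < n) :
    Polynomial.aeval (tau q v h) (∏ j, (Polynomial.X - Polynomial.C (v j))) = 0 := by
  have h1 := mk_rel (Rel.cyclotomic (q := q) (v := v) h)
  rw [list_prod_sub_eq_aeval, map_zero] at h1
  rwa [← Polynomial.aeval_algHom_apply] at h1

theorem tau_pow_mem_span {n : ℕ} (h : 0 < n) (a : ℕ) :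
    tau q v h ^ a ∈ Submodule.span K {x | ∃ i < m, x = tau q v h ^ i} := by
  have h1 := pow_mem_span_of_monic (Polynomial.monic_prod_X_sub_C v Finset.univ)
    (aeval_tau_eq_zero q v h) a
  rwa [Polynomial.natDegree_finsetProd_X_sub_C_eq_card, Finset.card_univ, Fintype.card_fin] at h1

/-- The generators of `H(m,1,n)` in `H(m,1,n+1)`. -/
noncomputable def genEmbedding (n : ℕ) : Gen n → HeckeAlgebra q v (n + 1)
  | Gen.tau _ => tau q v (n := n + 1) n.succ_pos
  | Gen.sigma i _ => sigmaFamily q v (n + 1) i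

/-- The natural homomorphism from `H(m,1,n)` to `H(m,1,n+1)`. -/
noncomputable def stepHom (n : ℕ) : HeckeAlgebra q v n →ₐ[K] HeckeAlgebra q v (n + 1) :=
  RingQuot.liftAlgHom K ⟨FreeAlgebra.lift K (genEmbedding q v n), by
    have H := isHeckeFamily q v n
    intro x y hxy
    cases hxy with
    | braid i h => simpa [genEmbedding] using H.braid i (by omega)
    | comm i j hij h => simpa [genEmbedding] using H.comm i j hij (by omega)
    | tau_braid h => simpa [genEmbedding] using H.tau_braid (by omega)
    | tau_comm i hi h => simpa [genEmbedding] using H.tau_comm i hi (by omega)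
    | quadratic i h => simpa [genEmbedding] using H.quadratic i (by omega)
    | cyclotomic h =>
      rw [list_prod_sub_eq_aeval, ← Polynomial.aeval_algHom_apply, map_zero]
      simpa [genEmbedding] using aeval_tau_eq_zero q v n.succ_pos⟩

theorem stepHom_tau {n : ℕ} (h : 0 < n) :
    stepHom q v n (tau q v h) = tau q v (n := n + 1) n.succ_pos := by
  simp [stepHom, tau, genEmbedding]

theorem stepHom_sigma {n i : ℕ} (h : i + 1 < n) :
    stepHom q v n (sigma q v i h) = sigmaFamily q v (n + 1) i := by
  simp [stepHom, sigma, genEmbedding]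

/-- The combinations of the `cosetElement`s with coefficients in `H(m,1,n)`. -/
noncomputable def cosetMap (n : ℕ) :
    (Fin (n + 1) × Fin m → HeckeAlgebra q v n) →ₗ[K] HeckeAlgebra q v (n + 1) :=
  ∑ p : Fin (n + 1) × Fin m,
    (LinearMap.mulLeft K
      (cosetElement (tau q v (n := n + 1) n.succ_pos) (sigmaFamily q v (n + 1)) n p.1 p.2)
      ∘ₗ (stepHom q v n).toLinearMap) ∘ₗ LinearMap.proj p

/-- Here B is the range of `stepHom`; whether `stepHom` is injective plays no role for an upper
bound. -/
theorem cosetMap_surjective (n : ℕ) : Function.Surjective (cosetMap q v n) := by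
  have H := isHeckeFamily q v n
  set t := tau q v (n := n + 1) n.succ_pos with ht
  set s := sigmaFamily q v (n + 1) with hs
  set B := (stepHom q v n).range with hB
  have hpow := tau_pow_mem_span q v n.succ_pos
  have hBt : 0 < n → t ∈ B := fun h => ⟨tau q v h, stepHom_tau q v h⟩
  have hBs : ∀ i, i + 1 < n → s i ∈ B := fun i h => ⟨sigma q v i h, stepHom_sigma q v h⟩
  have htop : cosetSpan t s n m B = ⊤ := by
    refine eq_top_of_generators_mul_mem q v (H.one_mem_cosetSpan hpow hBs) ?_ ?_
    · intro _ x hx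
      exact H.tau_mul_mem_cosetSpan hpow hBt hBs hx
    · intro i h x hx
      have := H.sigma_mul_mem_cosetSpan hpow hBs (i := i) (by omega) hx
      rwa [hs, sigmaFamily_of_lt h] at this
  rw [← LinearMap.range_eq_top, eq_top_iff, ← htop, cosetSpan, Submodule.span_le]
  rintro _ ⟨j, hj, a, ha, _, ⟨b, rfl⟩, rfl⟩
  refine ⟨Pi.single (⟨j, by omega⟩, ⟨a, ha⟩) b, ?_⟩
  rw [cosetMap, LinearMap.sum_apply, Finset.sum_eq_single (⟨j, by omega⟩, ⟨a, ha⟩)]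
  · simp [ht, hs]
  · intro p _ hp
    simp [Pi.single_eq_of_ne hp]
  · simp

theorem algebraMap_surjective_zero : Function.Surjective (algebraMap K (HeckeAlgebra q v 0)) := by
  have h : LinearMap.range (Algebra.linearMap K (HeckeAlgebra q v 0)) = ⊤ :=
    eq_top_of_generators_mul_mem q v ⟨1, by simp⟩ (fun h => absurd h (by omega))
      (fun i h => absurd h (by omega))
  exact LinearMap.range_eq_top.1 h

/-- `H(m,1,n)` is finite-dimensional of dimension at most `n! mⁿ`. -/
theorem finite_and_finrank_le (n : ℕ) : Module.Finite K (HeckeAlgebra q v n) ∧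
    Module.finrank K (HeckeAlgebra q v n) ≤ n.factorial * m ^ n := by
  induction n with
  | zero =>
    have h := algebraMap_surjective_zero q v
    refine ⟨Module.Finite.of_surjective (Algebra.linearMap K (HeckeAlgebra q v 0)) h, ?_⟩
    have := LinearMap.finrank_le_finrank_of_surjective
      (f := Algebra.linearMap K (HeckeAlgebra q v 0)) h
    simpa using this
  | succ n ih =>
    obtain ⟨hfin, hle⟩ := ih
    have h := cosetMap_surjective q v n
    refine ⟨Module.Finite.of_surjective _ h, ?_⟩
    refine (LinearMap.finrank_le_finrank_of_surjective h).trans ?_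
    rw [Module.finrank_pi_fintype, Finset.sum_const, Finset.card_univ, Fintype.card_prod,
      Fintype.card_fin, Fintype.card_fin, smul_eq_mul, Nat.factorial_succ, pow_succ]
    calc (n + 1) * m * Module.finrank K (HeckeAlgebra q v n)
        ≤ (n + 1) * m * (n.factorial * m ^ n) := Nat.mul_le_mul_left _ hle
      _ = _ := by ring

end DimensionBound

/-! ### Positions of the entries of a tableau -/

/-- Possible nodes of `m`-tuples of diagrams: `⟨k, (r, s)⟩` is the node in line `r` and column `s`
of the `k`-th diagram.  Nodes of different diagrams are incomparable. -/
abbrev Cell (m : ℕ) : Type := Σ _ : Fin m, ℕ × ℕ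

section Cells

variable {m n : ℕ}

theorem cell_le_iff {x y : Cell m} :
    x ≤ y ↔ x.1 = y.1 ∧ x.2.1 ≤ y.2.1 ∧ x.2.2 ≤ y.2.2 := by
  obtain ⟨k, a⟩ := x
  obtain ⟨l, b⟩ := y
  constructor
  · rintro ⟨_, _, _, hab⟩
    exact ⟨rfl, hab.1, hab.2⟩
  · rintro ⟨h, h1, h2⟩
    dsimp only at h
    subst h
    exact Sigma.mk_le_mk_iff.2 ⟨h1, h2⟩

theorem cell_ext {x y : Cell m} (h : x.1 = y.1) (h1 : x.2.1 = y.2.1) (h2 : x.2.2 = y.2.2) :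
    x = y :=
  le_antisymm (cell_le_iff.2 ⟨h, h1.le, h2.le⟩) (cell_le_iff.2 ⟨h.symm, h1.ge, h2.ge⟩)

/-- The set of nodes of an `m`-partition. -/
def cellsOf (lam : MultiPartition m n) : Finset (Cell m) :=
  Finset.univ.sigma fun k => (lam.diagram k).cells

theorem mem_cellsOf {lam : MultiPartition m n} {x : Cell m} :
    x ∈ cellsOf lam ↔ x.2 ∈ lam.diagram x.1 := by
  simp [cellsOf]

theorem card_cellsOf (lam : MultiPartition m n) : (cellsOf lam).card = n := by
  rw [cellsOf, Finset.card_sigma]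
  exact lam.sum_card

theorem isLowerSet_cellsOf (lam : MultiPartition m n) :
    IsLowerSet (cellsOf lam : Set (Cell m)) := by
  rintro ⟨k, a⟩ ⟨l, b⟩ hba ha
  obtain ⟨h, h1, h2⟩ := cell_le_iff.1 hba
  dsimp only at h
  subst h
  exact mem_cellsOf.2 ((lam.diagram _).up_left_mem h1 h2 (mem_cellsOf.1 ha))

theorem cellsOf_injective : Function.Injective (cellsOf : MultiPartition m n → Finset (Cell m)) := by
  intro lam mu h
  refine MultiPartition.ext (funext fun k => YoungDiagram.ext (Finset.ext fun c => ?_))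
  have := congrArg (fun S => (⟨k, c⟩ : Cell m) ∈ S) h
  simpa [mem_cellsOf] using this

/-- A lower set contains the hook through the ends of the first line and the first column. -/
theorem hook_card_le {S : Finset (Cell m)} (hS : IsLowerSet (S : Set (Cell m))) {x y : Cell m}
    (hx : x ∈ S) (hy : y ∈ S) : x.2.2 + y.2.1 + 1 ≤ S.card := by
  let f : Fin (x.2.2 + 1) ⊕ Fin y.2.1 → Cell m :=
    -- The column part starts in row 1, because the corner is already in the row part when both
    -- nodes lie in one diagram.
    Sum.elim (fun j => ⟨x.1, (0, j)⟩) (fun i => ⟨y.1, (i + 1, 0)⟩)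
  have hf : Function.Injective f := by
    rintro (a | a) (b | b) h
    · exact congrArg Sum.inl (Fin.ext (congrArg (fun c : Cell m => c.2.2) h))
    · exact absurd (congrArg (fun c : Cell m => c.2.1) h) (Nat.succ_ne_zero _).symm
    · exact absurd (congrArg (fun c : Cell m => c.2.1) h) (Nat.succ_ne_zero _)
    · exact congrArg Sum.inr (Fin.ext (Nat.succ_injective (congrArg (fun c : Cell m => c.2.1) h)))
  have hm : ∀ a, f a ∈ S := by
    rintro (a | a)
    · exact hS (cell_le_iff.2 ⟨rfl, Nat.zero_le _, Nat.le_of_lt_succ a.2⟩ : f (Sum.inl a) ≤ x) hx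
    · exact hS (cell_le_iff.2 ⟨rfl, a.2, Nat.zero_le _⟩ : f (Sum.inr a) ≤ y) hy
  have := Finset.card_le_card_of_injOn (s := Finset.univ) f (fun a _ => hm a) hf.injOn
  rw [Finset.card_univ, Fintype.card_sum, Fintype.card_fin, Fintype.card_fin] at this
  omega

/-- In different diagrams the row and the column do not share a corner, so one node is gained over
`hook_card_le`. This pays for the strict bounds on the exponent in the separation condition. -/
theorem hook_card_le_of_ne {S : Finset (Cell m)} (hS : IsLowerSet (S : Set (Cell m)))
    {x y : Cell m} (hx : x ∈ S) (hy : y ∈ S) (hne : x.1 ≠ y.1) :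
    x.2.2 + y.2.1 + 2 ≤ S.card := by
  let f : Fin (x.2.2 + 1) ⊕ Fin (y.2.1 + 1) → Cell m :=
    Sum.elim (fun j => ⟨x.1, (0, j)⟩) (fun i => ⟨y.1, (i, 0)⟩)
  have hf : Function.Injective f := by
    rintro (a | a) (b | b) h
    · exact congrArg Sum.inl (Fin.ext (congrArg (fun c : Cell m => c.2.2) h))
    · exact absurd (congrArg Sigma.fst h) hne
    · exact absurd (congrArg Sigma.fst h).symm hne
    · exact congrArg Sum.inr (Fin.ext (congrArg (fun c : Cell m => c.2.1) h))
  have hm : ∀ a, f a ∈ S := by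
    rintro (a | a)
    · exact hS (cell_le_iff.2 ⟨rfl, Nat.zero_le _, Nat.le_of_lt_succ a.2⟩ : f (Sum.inl a) ≤ x) hx
    · exact hS (cell_le_iff.2 ⟨rfl, Nat.le_of_lt_succ a.2, Nat.zero_le _⟩ : f (Sum.inr a) ≤ y) hy
  have := Finset.card_le_card_of_injOn (s := Finset.univ) f (fun a _ => hm a) hf.injOn
  rw [Finset.card_univ, Fintype.card_sum, Fintype.card_fin, Fintype.card_fin] at this
  omega

/-- The position of the entry `i` in a filling. -/
def posOf {lam : MultiPartition m n} (e : Node lam ≃ Fin n) (i : Fin n) : Cell m :=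
  ⟨(e.symm i).1, (e.symm i).2.1⟩

variable {lam : MultiPartition m n}

theorem posOf_entry (e : Node lam ≃ Fin n) (x : Node lam) : posOf e (e x) = ⟨x.1, x.2.1⟩ := by
  rw [posOf, e.symm_apply_apply]

theorem posOf_mem (e : Node lam ≃ Fin n) (i : Fin n) : posOf e i ∈ cellsOf lam :=
  mem_cellsOf.2 (e.symm i).2.2

theorem node_ext {x y : Node lam} (h : (⟨x.1, x.2.1⟩ : Cell m) = ⟨y.1, y.2.1⟩) : x = y := by
  obtain ⟨k, a, ha⟩ := x
  obtain ⟨l, b, hb⟩ := y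
  simp only [Sigma.mk.injEq, heq_eq_eq] at h
  obtain ⟨rfl, rfl⟩ := h
  rfl

theorem posOf_injective (e : Node lam ≃ Fin n) : Function.Injective (posOf e) := by
  intro i j h
  exact e.symm.injective (node_ext h)

theorem exists_posOf_eq (e : Node lam ≃ Fin n) {x : Cell m} (hx : x ∈ cellsOf lam) :
    ∃ i, posOf e i = x :=
  ⟨e ⟨x.1, x.2, mem_cellsOf.1 hx⟩, posOf_entry e _⟩

theorem eq_of_posOf_eq {e f : Node lam ≃ Fin n} (h : posOf e = posOf f) : e = f := by
  have : e.symm = f.symm := Equiv.ext fun i => node_ext (congrFun h i)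
  rw [← e.symm_symm, this, f.symm_symm]

theorem posOf_trans (e : Node lam ≃ Fin n) (g : Equiv.Perm (Fin n)) :
    posOf (e.trans g) = posOf e ∘ g.symm := rfl

/-- Standard fillings are the order-preserving enumerations of the poset of nodes: comparable nodes
are joined by a move along a row followed by a move down a column. -/
theorem isStandard_iff (e : Node lam ≃ Fin n) :
    IsStandard lam e ↔ ∀ i j, posOf e i ≤ posOf e j → i ≤ j := by
  constructor
  · rintro ⟨hr, hc⟩ i j hij
    obtain ⟨⟨k, ⟨r, s⟩, hx⟩, rfl⟩ := e.surjective i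
    obtain ⟨⟨l, ⟨r', s'⟩, hy⟩, rfl⟩ := e.surjective j
    rw [posOf_entry, posOf_entry] at hij
    obtain ⟨h, h1, h2⟩ := cell_le_iff.1 hij
    dsimp only at h h1 h2
    subst h
    have hz : (r, s') ∈ lam.diagram k := (lam.diagram k).up_left_mem h1 le_rfl hy
    have l1 : e ⟨k, (r, s), hx⟩ ≤ e ⟨k, (r, s'), hz⟩ := by
      rcases h2.lt_or_eq with h2 | rfl
      · exact (hr k r s s' hx hz h2).le
      · exact le_rfl
    have l2 : e ⟨k, (r, s'), hz⟩ ≤ e ⟨k, (r', s'), hy⟩ := by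
      rcases h1.lt_or_eq with h1 | rfl
      · exact (hc k r r' s' hz hy h1).le
      · exact le_rfl
    exact l1.trans l2
  · intro h
    constructor
    · intro k r s s' hx hy hlt
      refine lt_of_le_of_ne (h _ _ ?_) fun heq => ?_
      · rw [posOf_entry, posOf_entry]
        exact cell_le_iff.2 ⟨rfl, le_rfl, hlt.le⟩
      · have := e.injective heq
        simp only [Sigma.mk.injEq, heq_eq_eq, Subtype.mk.injEq, Prod.mk.injEq, true_and] at this
        omega
    · intro k r s s' hx hy hlt
      refine lt_of_le_of_ne (h _ _ ?_) fun heq => ?_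
      · rw [posOf_entry, posOf_entry]
        exact cell_le_iff.2 ⟨rfl, hlt.le, le_rfl⟩
      · have := e.injective heq
        simp only [Sigma.mk.injEq, heq_eq_eq, Subtype.mk.injEq, Prod.mk.injEq, true_and] at this
        omega

/-! ### Adjacent entries and diagonals of a standard tableau -/

namespace StandardTableau

/-- The position of the entry `i` in a standard tableau. -/
def pos (X : StandardTableau lam) : Fin n → Cell m := posOf X.entry

theorem pos_mem (X : StandardTableau lam) (i : Fin n) : X.pos i ∈ cellsOf lam := posOf_mem _ i

theorem pos_injective (X : StandardTableau lam) : Function.Injective X.pos := posOf_injective _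

theorem exists_pos_eq (X : StandardTableau lam) {x : Cell m} (hx : x ∈ cellsOf lam) :
    ∃ i, X.pos i = x := exists_posOf_eq _ hx

theorem le_of_pos_le (X : StandardTableau lam) {i j : Fin n} (h : X.pos i ≤ X.pos j) : i ≤ j :=
  (isStandard_iff _).1 X.standard i j h

theorem lt_of_pos_lt (X : StandardTableau lam) {i j : Fin n} (h : X.pos i < X.pos j) : i < j :=
  lt_of_le_of_ne (X.le_of_pos_le h.le) fun e => h.ne (congrArg X.pos e)

theorem eq_of_pos_eq {X Y : StandardTableau lam} (h : X.pos = Y.pos) : X = Y :=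
  StandardTableau.ext (eq_of_posOf_eq h)

/-- There are exactly n nodes, so injectivity already makes p a bijection onto them. -/
theorem exists_pos_eq_of_forall {p : Fin n → Cell m} (hinj : Function.Injective p)
    (hmem : ∀ i, p i ∈ cellsOf lam) (hord : ∀ i j, p i ≤ p j → i ≤ j) :
    ∃ X : StandardTableau lam, X.pos = p := by
  let f : Fin n → Node lam := fun i => ⟨(p i).1, (p i).2, mem_cellsOf.1 (hmem i)⟩
  have hf : Function.Injective f := by
    intro i j h
    have h' := congrArg (fun x : Node lam => (⟨x.1, x.2.1⟩ : Cell m)) h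
    exact hinj h'
  have hsurj : Function.Surjective f := by
    intro x
    have himg : Finset.univ.image p = cellsOf lam := by
      apply Finset.eq_of_subset_of_card_le
      · intro y hy
        obtain ⟨i, -, rfl⟩ := Finset.mem_image.1 hy
        exact hmem i
      · rw [card_cellsOf, Finset.card_image_of_injective _ hinj, Finset.card_univ,
          Fintype.card_fin]
    have hx : (⟨x.1, x.2.1⟩ : Cell m) ∈ cellsOf lam := mem_cellsOf.2 x.2.2
    rw [← himg] at hx
    obtain ⟨i, -, hi⟩ := Finset.mem_image.1 hx
    exact ⟨i, node_ext hi⟩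
  let e : Node lam ≃ Fin n := (Equiv.ofBijective f ⟨hf, hsurj⟩).symm
  have he : posOf e = p := rfl
  exact ⟨⟨e, (isStandard_iff e).2 (by rw [he]; exact hord)⟩, he⟩

instance (lam : MultiPartition m n) : Finite (StandardTableau lam) := by
  have : Function.Injective (fun (X : StandardTableau lam) (i : Fin n) =>
      (⟨X.pos i, X.pos_mem i⟩ : {x // x ∈ cellsOf lam})) := by
    intro X Y h
    exact eq_of_pos_eq (funext fun i => congrArg Subtype.val (congrFun h i))
  exact Finite.of_injective _ this

noncomputable instance (lam : MultiPartition m n) : Fintype (StandardTableau lam) :=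
  Fintype.ofFinite _

/-- If the position of `i + 1` is bigger than that of `i`, it is the next one in the same line or
column. -/
theorem pos_succ_of_lt (X : StandardTableau lam) {i : ℕ} (h : i + 1 < n)
    (hlt : X.pos ⟨i, by omega⟩ < X.pos ⟨i + 1, h⟩) :
    (X.pos ⟨i + 1, h⟩).1 = (X.pos ⟨i, by omega⟩).1 ∧
      (((X.pos ⟨i + 1, h⟩).2.1 = (X.pos ⟨i, by omega⟩).2.1 + 1 ∧
        (X.pos ⟨i + 1, h⟩).2.2 = (X.pos ⟨i, by omega⟩).2.2) ∨
      ((X.pos ⟨i + 1, h⟩).2.1 = (X.pos ⟨i, by omega⟩).2.1 ∧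
        (X.pos ⟨i + 1, h⟩).2.2 = (X.pos ⟨i, by omega⟩).2.2 + 1)) := by
  have hy := X.pos_mem ⟨i + 1, h⟩
  set x := X.pos ⟨i, by omega⟩ with hx
  set y := X.pos ⟨i + 1, h⟩ with hy'
  obtain ⟨h0, h1, h2⟩ := cell_le_iff.1 hlt.le
  -- A node between x and y would carry an entry between i and i + 1. Applied below to the
  -- neighbours of y above it and to its left.
  have between : ∀ z, x ≤ z → z < y → z = x := by
    intro z hxz hzy
    obtain ⟨l, rfl⟩ := X.exists_pos_eq (isLowerSet_cellsOf lam hzy.le hy)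
    have a1 := X.le_of_pos_le hxz
    have a2 := X.lt_of_pos_lt hzy
    rw [Fin.le_def] at a1
    rw [Fin.lt_def] at a2
    have : l = ⟨i, by omega⟩ := Fin.ext (by dsimp only at *; omega)
    rw [this]
  refine ⟨h0.symm, ?_⟩
  rcases h1.lt_or_eq with h1 | h1
  · left
    have := between ⟨y.1, (y.2.1 - 1, y.2.2)⟩ (cell_le_iff.2 ⟨h0, by dsimp only; omega, h2⟩)
      (lt_of_le_of_ne (cell_le_iff.2 ⟨rfl, by dsimp only; omega, le_rfl⟩) fun e => by
        have := congrArg (fun c : Cell m => c.2.1) e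
        dsimp only at this
        omega)
    rw [← this]
    dsimp only
    omega
  · right
    have h2 : x.2.2 < y.2.2 := lt_of_le_of_ne h2 fun e => hlt.ne (cell_ext h0 h1 e)
    have := between ⟨y.1, (y.2.1, y.2.2 - 1)⟩
      (cell_le_iff.2 ⟨h0, h1.le, by dsimp only; omega⟩)
      (lt_of_le_of_ne (cell_le_iff.2 ⟨rfl, le_rfl, by dsimp only; omega⟩) fun e => by
        have := congrArg (fun c : Cell m => c.2.2) e
        dsimp only at this
        omega)
    rw [← this]
    dsimp only
    omega

/-- Exchanging `i` and `i + 1` gives a standard filling if and only if their positions are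
incomparable. -/
theorem swap_isStandard_iff (X : StandardTableau lam) {i : ℕ} (h : i + 1 < n) :
    IsStandard lam (X.entry.trans (Equiv.swap ⟨i, by omega⟩ ⟨i + 1, h⟩)) ↔
      ¬ X.pos ⟨i, by omega⟩ < X.pos ⟨i + 1, h⟩ := by
  rw [isStandard_iff, posOf_trans, Equiv.symm_swap]
  change (∀ a b, X.pos (Equiv.swap _ _ a) ≤ X.pos (Equiv.swap _ _ b) → a ≤ b) ↔ _
  constructor
  · intro hs hlt
    have := hs ⟨i + 1, h⟩ ⟨i, by omega⟩ (by simpa using hlt.le)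
    rw [Fin.le_def] at this
    dsimp only at this
    omega
  · intro hn a b hab
    have hi : i < n := by omega
    have hle := X.le_of_pos_le hab
    by_contra hlt
    rw [not_le] at hlt
    have hne : a ≠ b := hlt.ne'
    simp only [Equiv.swap_apply_def] at hle
    rw [Fin.lt_def] at hlt
    by_cases hb : b = ⟨i, hi⟩
    · by_cases ha : a = ⟨i + 1, h⟩
      · subst ha hb
        rw [Equiv.swap_apply_left, Equiv.swap_apply_right] at hab
        exact hn (lt_of_le_of_ne hab fun e => by
          have := X.pos_injective e
          simp at this)
      · subst hb
        rw [if_neg hne, if_neg ha, if_pos rfl, Fin.le_def] at hle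
        have : a.1 ≠ i + 1 := fun e => ha (Fin.ext e)
        dsimp only at *
        omega
    · have hb' : b.1 ≠ i := fun e => hb (Fin.ext e)
      simp only [Fin.ext_iff, Fin.le_def] at hle
      split_ifs at hle <;> (try dsimp only at *) <;> omega

/-- Nodes on the same diagonal of the same diagram carry entries of distance at least `3`. -/
theorem add_three_le_of_diagonal (X : StandardTableau lam) {i j : Fin n} (hij : i < j)
    (h : (X.pos i).1 = (X.pos j).1)
    (hd : ((X.pos i).2.2 : ℤ) - (X.pos i).2.1 = (X.pos j).2.2 - (X.pos j).2.1) :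
    i.1 + 3 ≤ j.1 := by
  have hy := X.pos_mem j
  have hne : X.pos i ≠ X.pos j := fun e => hij.ne (X.pos_injective e)
  have hnle : ¬ X.pos j ≤ X.pos i := fun e => absurd (X.le_of_pos_le e) (not_le.2 hij)
  have hlt : (X.pos i).2.1 < (X.pos j).2.1 := by
    by_contra hle
    exact hnle (cell_le_iff.2 ⟨h.symm, by omega, by omega⟩)
  have hz : ∀ z : Cell m, X.pos i < z → z < X.pos j → ∃ l, X.pos l = z ∧ i < l ∧ l < j := by
    intro z h1 h2
    obtain ⟨l, rfl⟩ := X.exists_pos_eq (isLowerSet_cellsOf lam h2.le hy)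
    exact ⟨l, rfl, X.lt_of_pos_lt h1, X.lt_of_pos_lt h2⟩
  have hlt' : ∀ {z w : Cell m}, z.1 = w.1 → z.2.1 ≤ w.2.1 → z.2.2 ≤ w.2.2 →
      z.2.1 + z.2.2 < w.2.1 + w.2.2 → z < w := by
    intro z w e0 e1 e2 e3
    refine lt_of_le_of_ne (cell_le_iff.2 ⟨e0, e1, e2⟩) ?_
    rintro rfl
    exact lt_irrefl _ e3
  -- The neighbours of the position of i below it and to its right both precede the position of j;
  -- their two entries are distinct and lie strictly between i and j.
  obtain ⟨l1, e1, a1, b1⟩ := hz ⟨(X.pos i).1, ((X.pos i).2.1 + 1, (X.pos i).2.2)⟩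
    (hlt' rfl (by dsimp only; omega) le_rfl (by dsimp only; omega))
    (hlt' h (by dsimp only; omega) (by dsimp only; omega) (by dsimp only; omega))
  obtain ⟨l2, e2, a2, b2⟩ := hz ⟨(X.pos i).1, ((X.pos i).2.1, (X.pos i).2.2 + 1)⟩
    (hlt' rfl le_rfl (by dsimp only; omega) (by dsimp only; omega))
    (hlt' h (by dsimp only; omega) (by dsimp only; omega) (by dsimp only; omega))
  have hl : l1.1 ≠ l2.1 := by
    intro e
    rw [Fin.ext e, e2] at e1
    have := congrArg (fun c : Cell m => c.2.1) e1
    dsimp only at this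
    omega
  rw [Fin.lt_def] at a1 a2 b1 b2
  omega

/-- The first entry stands in a corner. -/
theorem pos_zero (X : StandardTableau lam) (h : 0 < n) :
    (X.pos ⟨0, h⟩).2 = (0, 0) := by
  have hle : (⟨(X.pos ⟨0, h⟩).1, (0, 0)⟩ : Cell m) ≤ X.pos ⟨0, h⟩ :=
    cell_le_iff.2 ⟨rfl, Nat.zero_le _, Nat.zero_le _⟩
  obtain ⟨l, hl⟩ := X.exists_pos_eq (isLowerSet_cellsOf lam hle (X.pos_mem _))
  rw [← hl] at hle
  have := X.le_of_pos_le hle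
  have hl0 : l = ⟨0, h⟩ := Fin.ext (by rw [Fin.le_def] at this; dsimp only at *; omega)
  rw [hl0] at hl
  rw [hl]

end StandardTableau

end Cells

/-! ### Contents -/

section Contents

variable {K : Type*} [Field K] {m n : ℕ} {q : K} {v : Fin m → K}

/-- By the geometric sum, q^(2d) = 1 with d > 0 forces q² = 1 or 1 + q² + ⋯ + q^(2(d-1)) = 0. The
extreme values d = ±n are included and correspond to N = n - 1. -/
theorem SemisimpleParameters.zpow_ne_one (P : SemisimpleParameters q v n) (hn : 2 ≤ n) {d : ℤ}
    (hd : d ≠ 0) (h1 : -(n : ℤ) ≤ d) (h2 : d ≤ n) : q ^ (2 * d) ≠ 1 := by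
  have hnat : ∀ N : ℕ, N < n → q ^ (2 * ((N : ℤ) + 1)) ≠ 1 := by
    intro N hN h
    have hs := P.qsum_ne_zero N hN
    have hg := geom_sum_mul (q ^ 2) (N + 1)
    have e : (q ^ 2) ^ (N + 1) = 1 := by
      rw [← pow_mul, ← zpow_natCast]
      push_cast
      exact h
    rw [e, sub_self, mul_eq_zero] at hg
    rcases hg with hg | hg
    · exact hs (by simpa only [← pow_mul] using hg)
    · exact P.q_sq_ne_one hn (sub_eq_zero.1 hg)
  rcases lt_or_gt_of_ne hd with h | h
  · obtain ⟨N, hN⟩ : ∃ N : ℕ, d = -((N : ℤ) + 1) := ⟨(-d - 1).toNat, by omega⟩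
    have := hnat N (by omega)
    rw [hN, mul_neg, zpow_neg]
    exact fun h => this (inv_eq_one.1 h)
  · obtain ⟨N, hN⟩ : ∃ N : ℕ, d = (N : ℤ) + 1 := ⟨(d - 1).toNat, by omega⟩
    rw [hN]
    exact hnat N (by omega)

/-- The content of a possible node. -/
def cellContent (q : K) (v : Fin m → K) (x : Cell m) : K :=
  v x.1 * q ^ (2 * ((x.2.2 : ℤ) - (x.2.1 : ℤ)))

theorem content_eq_cellContent {lam : MultiPartition m n} (X : StandardTableau lam) (i : Fin n) :
    content q v X i = cellContent q v (X.pos i) := rfl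

/-- Contents of nodes of different diagrams are not related by small powers of `q²`. -/
theorem SemisimpleParameters.fst_eq (P : SemisimpleParameters q v n) {x y : Cell m} {e : ℤ}
    (h : q ^ (2 * e) * cellContent q v x = cellContent q v y)
    (h1 : e + ((x.2.2 : ℤ) - x.2.1) - (y.2.2 - y.2.1) < n)
    (h2 : -(n : ℤ) < e + ((x.2.2 : ℤ) - x.2.1) - (y.2.2 - y.2.1)) : x.1 = y.1 := by
  by_contra hne
  refine P.separated _ x.1 y.1 hne h2 h1 (sub_eq_zero.2 ?_)
  have hq := P.q_ne_zero
  unfold cellContent at h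
  have h3 : q ^ (2 * ((y.2.2 : ℤ) - y.2.1)) ≠ 0 := zpow_ne_zero _ hq
  apply mul_right_cancel₀ h3
  rw [← h, mul_right_comm, ← zpow_add₀ hq, mul_left_comm, ← zpow_add₀ hq, mul_comm]
  congr 2
  ring

/-- Inside one diagram the nonzero factor v_k cancels, and `zpow_ne_one` applies to the remaining
power of q². -/
theorem SemisimpleParameters.diagonal_eq (P : SemisimpleParameters q v n) (hn : 2 ≤ n)
    {x y : Cell m} {e : ℤ} (h : q ^ (2 * e) * cellContent q v x = cellContent q v y)
    (hxy : x.1 = y.1)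
    (h1 : e + ((x.2.2 : ℤ) - x.2.1) - (y.2.2 - y.2.1) ≤ n)
    (h2 : -(n : ℤ) ≤ e + ((x.2.2 : ℤ) - x.2.1) - (y.2.2 - y.2.1)) :
    e + ((x.2.2 : ℤ) - x.2.1) = y.2.2 - y.2.1 := by
  by_contra hne
  refine P.zpow_ne_one hn (sub_ne_zero.2 hne) h2 h1 ?_
  have hq := P.q_ne_zero
  unfold cellContent at h
  rw [hxy, mul_left_comm] at h
  have h3 := mul_left_cancel₀ (P.v_ne_zero _) h
  have h4 : q ^ (2 * ((y.2.2 : ℤ) - y.2.1)) ≠ 0 := zpow_ne_zero _ hq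
  apply mul_right_cancel₀ h4
  rw [one_mul, ← zpow_add₀ hq]
  rw [← zpow_add₀ hq] at h3
  rw [← h3]
  congr 1
  ring

/-! ### What contents say about tableaux -/

namespace StandardTableau

variable {lam : MultiPartition m n}

/-- Equal contents force a common diagonal, where entries differ by at least 3. Distances 1 and 2
remain, and these are all that the quadratic and braid relations need. -/
theorem content_ne (P : SemisimpleParameters q v n) (X : StandardTableau lam) {i j : Fin n}
    (hij : i < j) (hj : j.1 < i.1 + 3) : content q v X i ≠ content q v X j := by
  intro h
  rw [content_eq_cellContent, content_eq_cellContent] at h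
  have h0 : q ^ (2 * (0 : ℤ)) * cellContent q v (X.pos i) = cellContent q v (X.pos j) := by
    simpa using h
  have c1 := hook_card_le (isLowerSet_cellsOf lam) (X.pos_mem i) (X.pos_mem j)
  have c2 := hook_card_le (isLowerSet_cellsOf lam) (X.pos_mem j) (X.pos_mem i)
  rw [card_cellsOf] at c1 c2
  have hk := P.fst_eq h0 (by omega) (by omega)
  have hd := P.diagonal_eq (by rw [Fin.lt_def] at hij; omega) h0 hk (by omega) (by omega)
  have := X.add_three_le_of_diagonal hij hk (by omega)
  omega

/-- The diagonals of such nodes differ by at least 2, which rules out a ratio of contents equal to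
q^(±2). -/
theorem incomparable_of_not_lt (X : StandardTableau lam) {i : ℕ} (h : i + 1 < n)
    (hn : ¬ X.pos ⟨i, by omega⟩ < X.pos ⟨i + 1, h⟩)
    (hk : (X.pos ⟨i, by omega⟩).1 = (X.pos ⟨i + 1, h⟩).1) :
    ((X.pos ⟨i, by omega⟩).2.1 < (X.pos ⟨i + 1, h⟩).2.1 ∧
      (X.pos ⟨i + 1, h⟩).2.2 < (X.pos ⟨i, by omega⟩).2.2) ∨
    ((X.pos ⟨i + 1, h⟩).2.1 < (X.pos ⟨i, by omega⟩).2.1 ∧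
      (X.pos ⟨i, by omega⟩).2.2 < (X.pos ⟨i + 1, h⟩).2.2) := by
  have h1 : ¬ X.pos ⟨i, by omega⟩ ≤ X.pos ⟨i + 1, h⟩ := by
    intro hle
    refine hn (lt_of_le_of_ne hle fun e => ?_)
    have := X.pos_injective e
    simp at this
  have h2 : ¬ X.pos ⟨i + 1, h⟩ ≤ X.pos ⟨i, by omega⟩ := by
    intro hle
    have := X.le_of_pos_le hle
    rw [Fin.le_def] at this
    dsimp only at this
    omega
  rw [cell_le_iff] at h1 h2
  have h3 := fun a b => h1 ⟨hk, a, b⟩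
  have h4 := fun a b => h2 ⟨hk.symm, a, b⟩
  omega

/-- The contents of `i` and `i + 1` differ by a factor `q²` exactly if exchanging them does not
give a standard tableau. -/
theorem content_adjacent_iff (P : SemisimpleParameters q v n) (X : StandardTableau lam) {i : ℕ}
    (h : i + 1 < n) :
    (content q v X ⟨i + 1, h⟩ = q ^ 2 * content q v X ⟨i, by omega⟩ ∨
      content q v X ⟨i, by omega⟩ = q ^ 2 * content q v X ⟨i + 1, h⟩) ↔
      X.pos ⟨i, by omega⟩ < X.pos ⟨i + 1, h⟩ := by
  rw [content_eq_cellContent, content_eq_cellContent]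
  have c1 := hook_card_le (isLowerSet_cellsOf lam) (X.pos_mem ⟨i, by omega⟩)
    (X.pos_mem ⟨i + 1, h⟩)
  have c2 := hook_card_le (isLowerSet_cellsOf lam) (X.pos_mem ⟨i + 1, h⟩)
    (X.pos_mem ⟨i, by omega⟩)
  have d1 := hook_card_le_of_ne (isLowerSet_cellsOf lam) (X.pos_mem ⟨i, by omega⟩)
    (X.pos_mem ⟨i + 1, h⟩)
  have d2 := hook_card_le_of_ne (isLowerSet_cellsOf lam) (X.pos_mem ⟨i + 1, h⟩)
    (X.pos_mem ⟨i, by omega⟩)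
  rw [card_cellsOf] at c1 c2 d1 d2
  constructor
  · intro hor
    by_contra hn
    have hcases := X.incomparable_of_not_lt h hn
    rcases hor with e | e
    · have e1 : q ^ (2 * (1 : ℤ)) * cellContent q v (X.pos ⟨i, by omega⟩) =
          cellContent q v (X.pos ⟨i + 1, h⟩) := by rw [e]; norm_cast
      have hk : (X.pos ⟨i, by omega⟩).1 = (X.pos ⟨i + 1, h⟩).1 := by
        by_contra hne
        have := d1 hne
        have := d2 (Ne.symm hne)
        exact hne (P.fst_eq e1 (by omega) (by omega))
      have := P.diagonal_eq (by omega) e1 hk (by omega) (by omega)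
      have := hcases hk
      omega
    · have e1 : q ^ (2 * (1 : ℤ)) * cellContent q v (X.pos ⟨i + 1, h⟩) =
          cellContent q v (X.pos ⟨i, by omega⟩) := by rw [e]; norm_cast
      have hk : (X.pos ⟨i, by omega⟩).1 = (X.pos ⟨i + 1, h⟩).1 := by
        by_contra hne
        have := d1 hne
        have := d2 (Ne.symm hne)
        exact hne (P.fst_eq e1 (by omega) (by omega)).symm
      have := P.diagonal_eq (by omega) e1 hk.symm (by omega) (by omega)
      have := hcases hk
      omega
  · intro hlt
    have hq := P.q_ne_zero
    obtain ⟨hk, ⟨h1, h2⟩ | ⟨h1, h2⟩⟩ := X.pos_succ_of_lt h hlt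
    · right
      unfold cellContent
      rw [hk, h1, h2, mul_left_comm, ← zpow_natCast, ← zpow_add₀ hq]
      congr 2
      push_cast
      ring
    · left
      unfold cellContent
      rw [hk, h1, h2, mul_left_comm, ← zpow_natCast, ← zpow_add₀ hq]
      congr 2
      push_cast
      ring

/-- The positions of a tableau are determined by the sequence of contents. -/
theorem pos_eq_of_content_eq (P : SemisimpleParameters q v n) {mu : MultiPartition m n}
    (X : StandardTableau lam) (Y : StandardTableau mu)
    (hXY : ∀ i, content q v X i = content q v Y i) : X.pos = Y.pos := by
  suffices H : ∀ (i : ℕ) (h : i < n), X.pos ⟨i, h⟩ = Y.pos ⟨i, h⟩ from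
    funext fun i => H i.1 i.2
  intro i
  induction i using Nat.strong_induction_on with
  | _ i ih =>
  intro h
  set x := X.pos ⟨i, h⟩ with hx
  set y := Y.pos ⟨i, h⟩ with hy
  -- By induction S holds the positions of the earlier entries in both tableaux, so x and y are both
  -- addable to S.
  let S : Finset (Cell m) := Finset.univ.image fun j : Fin i => X.pos ⟨j, by omega⟩
  have hSX : ∀ z, z < x → z ∈ S := by
    intro z hz
    obtain ⟨l, rfl⟩ := X.exists_pos_eq (isLowerSet_cellsOf lam hz.le (X.pos_mem _))
    have := X.lt_of_pos_lt hz
    exact Finset.mem_image.2 ⟨⟨l, this⟩, Finset.mem_univ _, rfl⟩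
  have hSY : ∀ z, z < y → z ∈ S := by
    intro z hz
    obtain ⟨l, rfl⟩ := Y.exists_pos_eq (isLowerSet_cellsOf mu hz.le (Y.pos_mem _))
    have := Y.lt_of_pos_lt hz
    exact Finset.mem_image.2 ⟨⟨l, this⟩, Finset.mem_univ _, ih l this _⟩
  have hxS : x ∉ S := by
    intro hm
    obtain ⟨j, -, hj⟩ := Finset.mem_image.1 hm
    have := congrArg Fin.val (X.pos_injective hj)
    exact absurd this j.2.ne
  have hyS : y ∉ S := by
    intro hm
    obtain ⟨j, -, hj⟩ := Finset.mem_image.1 hm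
    rw [ih j j.2 _] at hj
    have := congrArg Fin.val (Y.pos_injective hj)
    exact absurd this j.2.ne
  have hSlow : IsLowerSet (S : Set (Cell m)) := by
    intro a b hba ha
    obtain ⟨j, -, rfl⟩ := Finset.mem_image.1 (Finset.mem_coe.1 ha)
    obtain ⟨l, rfl⟩ := X.exists_pos_eq (isLowerSet_cellsOf lam hba (X.pos_mem _))
    have := X.le_of_pos_le hba
    rw [Fin.le_def] at this
    have hj := j.2
    exact Finset.mem_coe.2 (Finset.mem_image.2
      ⟨⟨l, by dsimp only at this; omega⟩, Finset.mem_univ _, rfl⟩)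
  have hScard : S.card ≤ i := Finset.card_image_le.trans (by simp)
  -- x and y may belong to different shapes, so the hook bounds are applied to this common lower
  -- set. It may have n + 1 nodes, which is why exponents ±n must be allowed within a diagram.
  set T : Finset (Cell m) := insert x (insert y S) with hT
  have hTlow : IsLowerSet (T : Set (Cell m)) := by
    intro a b hba ha
    rcases hba.lt_or_eq with hlt | rfl
    · rcases Finset.mem_insert.1 (Finset.mem_coe.1 ha) with rfl | ha
      · exact Finset.mem_coe.2 (Finset.mem_insert_of_mem (Finset.mem_insert_of_mem (hSX b hlt)))
      · rcases Finset.mem_insert.1 ha with rfl | ha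
        · exact Finset.mem_coe.2
            (Finset.mem_insert_of_mem (Finset.mem_insert_of_mem (hSY b hlt)))
        · exact Finset.mem_coe.2
            (Finset.mem_insert_of_mem (Finset.mem_insert_of_mem (hSlow hba ha)))
    · exact ha
  have hTcard : T.card ≤ n + 1 := by
    have h1 : T.card ≤ _ := Finset.card_insert_le x (insert y S)
    have h2 := Finset.card_insert_le y S
    omega
  have hxT : x ∈ T := Finset.mem_insert_self _ _
  have hyT : y ∈ T := Finset.mem_insert_of_mem (Finset.mem_insert_self _ _)
  have h0 : q ^ (2 * (0 : ℤ)) * cellContent q v x = cellContent q v y := by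
    rw [mul_zero, zpow_zero, one_mul]
    exact hXY ⟨i, h⟩
  have hk : x.1 = y.1 := by
    by_contra hne
    have c1 := hook_card_le_of_ne hTlow hxT hyT hne
    have c2 := hook_card_le_of_ne hTlow hyT hxT (Ne.symm hne)
    exact hne (P.fst_eq h0 (by omega) (by omega))
  rcases Nat.eq_zero_or_pos i with rfl | hi
  · refine cell_ext hk ?_ ?_
    · rw [hx, hy, X.pos_zero, Y.pos_zero]
    · rw [hx, hy, X.pos_zero, Y.pos_zero]
  · have c1 := hook_card_le hTlow hxT hyT
    have c2 := hook_card_le hTlow hyT hxT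
    have hd := P.diagonal_eq (by omega) h0 hk (by omega) (by omega)
    -- Two nodes on one diagonal are comparable, so the smaller one would already lie in S.
    by_contra hne
    rcases le_total x.2.1 y.2.1 with hle | hle
    · exact hxS (hSY x (lt_of_le_of_ne (cell_le_iff.2 ⟨hk, hle, by omega⟩) hne))
    · exact hyS (hSX y (lt_of_le_of_ne (cell_le_iff.2 ⟨hk.symm, hle, by omega⟩) (Ne.symm hne)))

theorem sigma_eq_of_pos_eq {mu : MultiPartition m n} {X : StandardTableau lam}
    {Y : StandardTableau mu} (h : X.pos = Y.pos) :
    (⟨lam, X⟩ : Σ nu : MultiPartition m n, StandardTableau nu) = ⟨mu, Y⟩ := by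
  have hlm : lam = mu := by
    apply cellsOf_injective
    ext x
    constructor
    · intro hx
      obtain ⟨i, rfl⟩ := X.exists_pos_eq hx
      rw [h]
      exact Y.pos_mem i
    · intro hx
      obtain ⟨i, rfl⟩ := Y.exists_pos_eq hx
      rw [← h]
      exact X.pos_mem i
  subst hlm
  rw [eq_of_pos_eq h]

end StandardTableau

end Contents

/-! ### Hecke operators on sequences -/

section SequenceModel

variable {K ι κ : Type*} [Field K]

/-- The diagonal coefficient of the Hecke operators. -/
def diagCoeff (q x y : K) : K := -((q - q⁻¹) * (y / (x - y)))

open Classical in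
/-- The off-diagonal coefficient of the Hecke operators, set to zero for adjacent contents. -/
noncomputable def swapCoeff (q x y : K) : K :=
  if y = q ^ 2 * x ∨ x = q ^ 2 * y then 0 else (q * y - q⁻¹ * x) / (y - x)

/-- For adjacent contents one of the two original coefficients vanishes. Putting both to 0 therefore
keeps their product, and only this product enters the relations. -/
theorem swapCoeff_mul_swapCoeff {q x y : K} (hq : q ≠ 0) (hxy : x ≠ y) :
    swapCoeff q x y * swapCoeff q y x =
      (q - q⁻¹) * diagCoeff q x y + 1 - diagCoeff q x y ^ 2 := by
  have h1 : x - y ≠ 0 := sub_ne_zero.2 hxy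
  have h2 : y - x ≠ 0 := sub_ne_zero.2 hxy.symm
  have key : (q * y - q⁻¹ * x) / (y - x) * ((q * x - q⁻¹ * y) / (x - y)) =
      (q - q⁻¹) * diagCoeff q x y + 1 - diagCoeff q x y ^ 2 := by
    have h3 : y - x = -(x - y) := by ring
    unfold diagCoeff
    rw [h3]
    field_simp
    ring
  by_cases h : y = q ^ 2 * x ∨ x = q ^ 2 * y
  · rw [swapCoeff, if_pos h, zero_mul, ← key]
    rcases h with h | h
    · have : q * x - q⁻¹ * y = 0 := by rw [h]; field_simp; ring
      rw [this, zero_div, mul_zero]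
    · have : q * y - q⁻¹ * x = 0 := by rw [h]; field_simp; ring
      rw [this, zero_div, zero_mul]
  · rw [swapCoeff, if_neg h, swapCoeff, if_neg (fun h' => h h'.symm), key]

theorem diagCoeff_mul_add {q x y : K} (hxy : x ≠ y) :
    diagCoeff q x y * x + diagCoeff q y x * y = 0 := by
  have h1 : x - y ≠ 0 := sub_ne_zero.2 hxy
  have h3 : y - x = -(x - y) := by ring
  unfold diagCoeff
  rw [h3]
  field_simp
  ring

theorem diagCoeff_add {q x y : K} (hxy : x ≠ y) :
    diagCoeff q x y + diagCoeff q y x = q - q⁻¹ := by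
  have h1 : x - y ≠ 0 := sub_ne_zero.2 hxy
  have h3 : y - x = -(x - y) := by ring
  unfold diagCoeff
  rw [h3]
  field_simp
  ring

theorem diagCoeff_braid {q x y z : K} (hxy : x ≠ y) (hyz : y ≠ z) (hxz : x ≠ z) :
    diagCoeff q x y * diagCoeff q y z + diagCoeff q x z * diagCoeff q y x =
      diagCoeff q y z * diagCoeff q x z := by
  have h1 : x - y ≠ 0 := sub_ne_zero.2 hxy
  have h2 : y - z ≠ 0 := sub_ne_zero.2 hyz
  have h3 : x - z ≠ 0 := sub_ne_zero.2 hxz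
  have h4 : y - x = -(x - y) := by ring
  unfold diagCoeff
  rw [h4, div_neg]
  generalize q - q⁻¹ = δ
  field_simp
  ring

/-- The Hecke operator for the entries `a` and `b` on the space spanned by the sequences of
elements of `κ`, where `χ` gives the contents. -/
noncomputable def seqOp [DecidableEq ι] (q : K) (χ : κ → K) (a b : ι) :
    Module.End K ((ι → κ) →₀ K) :=
  Finsupp.linearCombination K fun p =>
    diagCoeff q (χ (p a)) (χ (p b)) • Finsupp.single p (1 : K) +
      swapCoeff q (χ (p a)) (χ (p b)) • Finsupp.single (p ∘ Equiv.swap a b) (1 : K)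

/-- The operator which multiplies a sequence by the content of the entry `a`. -/
noncomputable def seqContentOp (χ : κ → K) (a : ι) : Module.End K ((ι → κ) →₀ K) :=
  Finsupp.linearCombination K fun p => χ (p a) • Finsupp.single p (1 : K)

/-! ### The relations for the operators on sequences -/

variable {q : K} {χ : κ → K}

theorem seqContentOp_single (a : ι) (p : ι → κ) :
    seqContentOp χ a (Finsupp.single p 1) = χ (p a) • Finsupp.single p (1 : K) := by
  rw [seqContentOp, Finsupp.linearCombination_single, one_smul]

variable [DecidableEq ι]

theorem seqOp_single (a b : ι) (p : ι → κ) :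
    seqOp q χ a b (Finsupp.single p 1) =
      diagCoeff q (χ (p a)) (χ (p b)) • Finsupp.single p (1 : K) +
      swapCoeff q (χ (p a)) (χ (p b)) • Finsupp.single (p ∘ Equiv.swap a b) (1 : K) := by
  rw [seqOp, Finsupp.linearCombination_single, one_smul]

theorem comp_swap_comp_swap (a b : ι) (p : ι → κ) :
    (p ∘ Equiv.swap a b) ∘ Equiv.swap a b = p := by
  funext j; simp

/-- On `p` and its exchange the operator is given by a 2×2 matrix of trace q - q⁻¹ and determinant
-1. -/
theorem seqOp_quadratic (hq : q ≠ 0) {a b : ι} {p : ι → κ} (h : χ (p a) ≠ χ (p b)) :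
    seqOp q χ a b (seqOp q χ a b (Finsupp.single p 1)) =
      (q - q⁻¹) • seqOp q χ a b (Finsupp.single p 1) + Finsupp.single p 1 := by
  simp only [seqOp_single, map_add, map_smul, comp_swap_comp_swap, Function.comp_apply,
    Equiv.swap_apply_left, Equiv.swap_apply_right]
  have h1 := swapCoeff_mul_swapCoeff hq h
  have h2 := diagCoeff_add (q := q) h
  have h3 : diagCoeff q (χ (p b)) (χ (p a)) = (q - q⁻¹) - diagCoeff q (χ (p a)) (χ (p b)) := by
    rw [← h2]; ring
  rw [h3]
  simp only [smul_add, smul_smul, h1]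
  module

/-- The recursion J_{i+1} = σ_i J_i σ_i of the Jucys–Murphy elements, on sequences. -/
theorem seqOp_content (hq : q ≠ 0) {a b : ι} {p : ι → κ} (h : χ (p a) ≠ χ (p b)) :
    seqOp q χ a b (seqContentOp χ a (seqOp q χ a b (Finsupp.single p 1))) =
      seqContentOp χ b (Finsupp.single p 1) := by
  simp only [seqOp_single, seqContentOp_single, map_add, map_smul, comp_swap_comp_swap,
    Function.comp_apply, Equiv.swap_apply_left, Equiv.swap_apply_right, smul_add, smul_smul]
  set x := χ (p a)
  set y := χ (p b)
  have h1 := swapCoeff_mul_swapCoeff hq h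
  have h2 := diagCoeff_mul_add (q := q) h
  have h3 : diagCoeff q x y * (x - y) = -((q - q⁻¹) * y) := by
    unfold diagCoeff
    rw [neg_mul, mul_assoc, div_mul_cancel₀ _ (sub_ne_zero.2 h)]
  have e1 : diagCoeff q x y * x * diagCoeff q x y +
      swapCoeff q x y * y * swapCoeff q y x = y := by
    linear_combination y * h1 + diagCoeff q x y * h3
  have e2 : diagCoeff q x y * x * swapCoeff q x y +
      swapCoeff q x y * y * diagCoeff q y x = 0 := by
    linear_combination swapCoeff q x y * h2
  linear_combination (norm := module) e1 • (Finsupp.single p (1 : K)) +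
    e2 • Finsupp.single (p ∘ Equiv.swap a b) (1 : K)

theorem seqOp_comm {a b c d : ι} (hac : a ≠ c) (had : a ≠ d) (hbc : b ≠ c) (hbd : b ≠ d)
    (p : ι → κ) :
    seqOp q χ a b (seqOp q χ c d (Finsupp.single p 1)) =
      seqOp q χ c d (seqOp q χ a b (Finsupp.single p 1)) := by
  have e : (p ∘ Equiv.swap c d) ∘ Equiv.swap a b = (p ∘ Equiv.swap a b) ∘ Equiv.swap c d := by
    have hd : Equiv.swap c d * Equiv.swap a b = Equiv.swap a b * Equiv.swap c d := by
      rw [Equiv.mul_swap_eq_swap_mul, Equiv.swap_apply_of_ne_of_ne hac had,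
        Equiv.swap_apply_of_ne_of_ne hbc hbd]
    rw [Function.comp_assoc, Function.comp_assoc]
    exact congrArg (fun g : Equiv.Perm ι => p ∘ g) hd
  simp only [seqOp_single, map_add, map_smul, Function.comp_apply, e,
    Equiv.swap_apply_of_ne_of_ne hac had, Equiv.swap_apply_of_ne_of_ne hbc hbd,
    Equiv.swap_apply_of_ne_of_ne hac.symm hbc.symm, Equiv.swap_apply_of_ne_of_ne had.symm hbd.symm]
  module

theorem seqContentOp_comm {a c d : ι} (hac : a ≠ c) (had : a ≠ d) (p : ι → κ) :
    seqContentOp χ a (seqOp q χ c d (Finsupp.single p 1)) =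
      seqOp q χ c d (seqContentOp χ a (Finsupp.single p 1)) := by
  simp only [seqOp_single, seqContentOp_single, map_add, map_smul, Function.comp_apply,
    Equiv.swap_apply_of_ne_of_ne hac had]
  module

/-- Both sides are combinations of the six permutations of `p` in the places a, b, c. The
coefficients at permutations of length at least 2 agree by commutativity; c0, c1 and c2 below treat
the other three. -/
theorem seqOp_braid (hq : q ≠ 0) {a b c : ι} (hab : a ≠ b) (hbc : b ≠ c) (hac : a ≠ c)
    {p : ι → κ} (h1 : χ (p a) ≠ χ (p b)) (h2 : χ (p b) ≠ χ (p c)) (h3 : χ (p a) ≠ χ (p c)) :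
    seqOp q χ a b (seqOp q χ b c (seqOp q χ a b (Finsupp.single p 1))) =
      seqOp q χ b c (seqOp q χ a b (seqOp q χ b c (Finsupp.single p 1))) := by
  have e : ((p ∘ Equiv.swap a b) ∘ Equiv.swap b c) ∘ Equiv.swap a b =
      ((p ∘ Equiv.swap b c) ∘ Equiv.swap a b) ∘ Equiv.swap b c := by
    have hd : Equiv.swap a b * Equiv.swap b c * Equiv.swap a b =
        Equiv.swap b c * Equiv.swap a b * Equiv.swap b c := by
      rw [Equiv.swap_mul_swap_mul_swap hab hac, Equiv.swap_comm a b, Equiv.swap_comm b c,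
        Equiv.swap_mul_swap_mul_swap hbc.symm hac.symm, Equiv.swap_comm]
    simp only [Function.comp_assoc]
    exact congrArg (fun g : Equiv.Perm ι => p ∘ g) hd
  simp only [seqOp_single, map_add, map_smul, comp_swap_comp_swap, Function.comp_apply,
    Equiv.swap_apply_left, Equiv.swap_apply_right, Equiv.swap_apply_of_ne_of_ne hab hac,
    Equiv.swap_apply_of_ne_of_ne hac.symm hbc.symm, e]
  set x := χ (p a)
  set y := χ (p b)
  set z := χ (p c)
  have k1 := swapCoeff_mul_swapCoeff hq h1
  have k2 := swapCoeff_mul_swapCoeff hq h2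
  have b1 := diagCoeff_braid (q := q) h1 h2 h3
  have b2 := diagCoeff_add (q := q) h1
  have b3 := diagCoeff_add (q := q) h2
  have c0 : diagCoeff q x y * diagCoeff q y z * diagCoeff q x y +
      swapCoeff q x y * diagCoeff q x z * swapCoeff q y x =
      diagCoeff q y z * diagCoeff q x y * diagCoeff q y z +
      swapCoeff q y z * diagCoeff q x z * swapCoeff q z y := by
    linear_combination diagCoeff q x z * k1 - diagCoeff q x z * k2 +
      (diagCoeff q x y - diagCoeff q y z) * (b1 - diagCoeff q x z * b2)
  have c1 : diagCoeff q x y * diagCoeff q y z * swapCoeff q x y +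
      swapCoeff q x y * diagCoeff q x z * diagCoeff q y x =
      diagCoeff q y z * swapCoeff q x y * diagCoeff q x z := by
    linear_combination swapCoeff q x y * b1
  have c2 : diagCoeff q x y * swapCoeff q y z * diagCoeff q x z =
      diagCoeff q y z * diagCoeff q x y * swapCoeff q y z +
      swapCoeff q y z * diagCoeff q x z * diagCoeff q z y := by
    linear_combination swapCoeff q y z * (-b1 + diagCoeff q x z * (b2 - b3))
  linear_combination (norm := module) c0 • (Finsupp.single p (1 : K)) +
    c1 • Finsupp.single (p ∘ Equiv.swap a b) (1 : K) +
    c2 • Finsupp.single (p ∘ Equiv.swap b c) (1 : K)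

end SequenceModel

/-! ### The representations on standard tableaux -/

section Representation

variable {K : Type*} [Field K] {m n : ℕ} {q : K} {v : Fin m → K}

/-- The embedding of the space of tableaux into the space of sequences of nodes. -/
noncomputable def posMap (K : Type*) [Field K] (lam : MultiPartition m n) :
    TableauSpace K lam →ₗ[K] ((Fin n → Cell m) →₀ K) :=
  Finsupp.lmapDomain K K StandardTableau.pos

theorem posMap_single {lam : MultiPartition m n} (X : StandardTableau lam) (c : K) :
    posMap K lam (Finsupp.single X c) = Finsupp.single X.pos c := by
  simp [posMap]

theorem posMap_injective (lam : MultiPartition m n) : Function.Injective (posMap K lam) :=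
  Finsupp.mapDomain_injective fun _ _ h => StandardTableau.eq_of_pos_eq h

/-- Operators on the space of tableaux which agree on tableaux after `posMap` are equal. -/
theorem end_ext_posMap {lam : MultiPartition m n} {f g : Module.End K (TableauSpace K lam)}
    (h : ∀ X : StandardTableau lam,
      posMap K lam (f (Finsupp.single X 1)) = posMap K lam (g (Finsupp.single X 1))) : f = g := by
  refine Finsupp.lhom_ext' fun X => LinearMap.ext_ring ?_
  exact posMap_injective lam (h X)

theorem sigmaOp_single {lam : MultiPartition m n} (X : StandardTableau lam) {i : ℕ}
    (h : i + 1 < n) : sigmaOp q v lam i h (Finsupp.single X 1) =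
      (-((q - q⁻¹) * (content q v X ⟨i + 1, h⟩ /
        (content q v X ⟨i, by omega⟩ - content q v X ⟨i + 1, h⟩)))) • Finsupp.single X (1 : K)
      + ((q * content q v X ⟨i + 1, h⟩ - q⁻¹ * content q v X ⟨i, by omega⟩) /
        (content q v X ⟨i + 1, h⟩ - content q v X ⟨i, by omega⟩)) • swapVector K X i h := by
  rw [sigmaOp, Finsupp.linearCombination_single, one_smul]

/-- The coefficient that `swapCoeff` kills is exactly the one in front of a nonstandard exchange.
The relations can thus be checked on sequences without asking which fillings are standard. -/
theorem posMap_sigmaOp (P : SemisimpleParameters q v n) {lam : MultiPartition m n} {i : ℕ}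
    (h : i + 1 < n) (w : TableauSpace K lam) :
    posMap K lam (sigmaOp q v lam i h w) =
      seqOp q (cellContent q v) ⟨i, by omega⟩ ⟨i + 1, h⟩ (posMap K lam w) := by
  suffices H : posMap K lam ∘ₗ sigmaOp q v lam i h =
      seqOp q (cellContent q v) ⟨i, by omega⟩ ⟨i + 1, h⟩ ∘ₗ posMap K lam from
    LinearMap.congr_fun H w
  refine Finsupp.lhom_ext' fun X => LinearMap.ext_ring ?_
  change posMap K lam (sigmaOp q v lam i h (Finsupp.single X 1)) =
    seqOp q (cellContent q v) ⟨i, by omega⟩ ⟨i + 1, h⟩ (posMap K lam (Finsupp.single X 1))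
  rw [sigmaOp_single, posMap_single, seqOp_single, map_add, map_smul, map_smul, posMap_single]
  congr 1
  by_cases hs : IsStandard lam (X.entry.trans (Equiv.swap ⟨i, by omega⟩ ⟨i + 1, h⟩))
  · have hw := (not_congr (X.content_adjacent_iff P h)).2 ((X.swap_isStandard_iff h).1 hs)
    rw [content_eq_cellContent, content_eq_cellContent] at hw
    rw [swapVector, dif_pos hs, posMap_single, swapCoeff, if_neg hw]
    rfl
  · have hw := (X.content_adjacent_iff P h).2
      (not_not.1 (mt (X.swap_isStandard_iff h).2 hs))
    rw [content_eq_cellContent, content_eq_cellContent] at hw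
    rw [swapVector, dif_neg hs, map_zero, smul_zero, swapCoeff, if_pos hw, zero_smul]

/-- The diagonal operators on the space of tableaux. -/
noncomputable def diagOp (K : Type*) [Field K] (lam : MultiPartition m n) :
    (StandardTableau lam → K) →ₐ[K] Module.End K (TableauSpace K lam) :=
  AlgHom.ofLinearMap
    { toFun := fun g => Finsupp.linearCombination K fun X => g X • Finsupp.single X (1 : K)
      map_add' := fun f g => Finsupp.lhom_ext' fun X => LinearMap.ext_ring (by
        simp)
      map_smul' := fun c g => Finsupp.lhom_ext' fun X => LinearMap.ext_ring (by simp) }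
    (Finsupp.lhom_ext' fun X => LinearMap.ext_ring (by simp))
    (fun f g => Finsupp.lhom_ext' fun X => LinearMap.ext_ring (by
      simp [mul_comm]))

theorem diagOp_single {lam : MultiPartition m n} (g : StandardTableau lam → K)
    (X : StandardTableau lam) :
    diagOp K lam g (Finsupp.single X 1) = g X • Finsupp.single X (1 : K) := by
  change Finsupp.linearCombination K (fun X => g X • Finsupp.single X (1 : K)) _ = _
  rw [Finsupp.linearCombination_single, one_smul]

theorem tauOp_eq_diagOp (lam : MultiPartition m n) (h : 0 < n) :
    tauOp q v lam h = diagOp K lam fun X => content q v X ⟨0, h⟩ := rfl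

theorem posMap_diagOp_content {lam : MultiPartition m n} (i : Fin n) (w : TableauSpace K lam) :
    posMap K lam (diagOp K lam (fun X => content q v X i) w) =
      seqContentOp (cellContent q v) i (posMap K lam w) := by
  suffices H : posMap K lam ∘ₗ diagOp K lam (fun X => content q v X i) =
      seqContentOp (cellContent q v) i ∘ₗ posMap K lam from
    LinearMap.congr_fun H w
  refine Finsupp.lhom_ext' fun X => LinearMap.ext_ring ?_
  change posMap K lam (diagOp K lam (fun X => content q v X i) (Finsupp.single X 1)) =
    seqContentOp (cellContent q v) i (posMap K lam (Finsupp.single X 1))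
  rw [diagOp_single, map_smul, posMap_single, seqContentOp_single, content_eq_cellContent]

theorem sigmaOp_mul_content_mul_sigmaOp (P : SemisimpleParameters q v n)
    (lam : MultiPartition m n) {i : ℕ} (h : i + 1 < n) :
    sigmaOp q v lam i h * diagOp K lam (fun X => content q v X ⟨i, by omega⟩) *
      sigmaOp q v lam i h = diagOp K lam fun X => content q v X ⟨i + 1, h⟩ := by
  refine end_ext_posMap fun X => ?_
  simp only [Module.End.mul_apply, posMap_sigmaOp P, posMap_diagOp_content, posMap_single]
  exact seqOp_content P.q_ne_zero (X.content_ne P (by simp [Fin.lt_def]) (by simp))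

/-- The number 1 stands in the corner of some diagram, so its content is one of the v_k. -/
theorem aeval_tauOp (lam : MultiPartition m n) (h : 0 < n) :
    Polynomial.aeval (tauOp q v lam h) (∏ j, (Polynomial.X - Polynomial.C (v j))) = 0 := by
  rw [tauOp_eq_diagOp, Polynomial.aeval_algHom_apply]
  convert map_zero (diagOp K lam)
  funext X
  have hc : content q v X ⟨0, h⟩ = v (X.pos ⟨0, h⟩).1 := by
    rw [content_eq_cellContent, cellContent, X.pos_zero]
    simp
  simp only [map_prod, map_sub, Polynomial.aeval_X, Polynomial.aeval_C, Finset.prod_apply,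
    Pi.sub_apply, Pi.algebraMap_apply, Algebra.algebraMap_self, RingHom.id_apply, Pi.zero_apply]
  exact Finset.prod_eq_zero (Finset.mem_univ (X.pos ⟨0, h⟩).1) (by rw [hc, sub_self])

/-- The operators by which the generators act. -/
noncomputable def genOp (q : K) (v : Fin m → K) (lam : MultiPartition m n) :
    Gen n → Module.End K (TableauSpace K lam)
  | Gen.tau h => tauOp q v lam h
  | Gen.sigma i h => sigmaOp q v lam i h

theorem lift_genOp_rel (P : SemisimpleParameters q v n) (lam : MultiPartition m n)
    {x y : FreeAlgebra K (Gen n)} (hxy : Rel q v n x y) :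
    FreeAlgebra.lift K (genOp q v lam) x = FreeAlgebra.lift K (genOp q v lam) y := by
  have hq := P.q_ne_zero
  cases hxy with
  | braid i h =>
    simp only [map_mul, FreeAlgebra.lift_ι_apply, genOp]
    refine end_ext_posMap fun X => ?_
    simp only [Module.End.mul_apply, posMap_sigmaOp P, posMap_single]
    exact seqOp_braid hq (by simp) (by simp) (by simp [add_assoc])
      (X.content_ne P (by simp [Fin.lt_def]) (by simp))
      (X.content_ne P (by simp [Fin.lt_def]) (by simp))
      (X.content_ne P (by simp [Fin.lt_def]) (by simp))
  | comm i j hij h =>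
    simp only [map_mul, FreeAlgebra.lift_ι_apply, genOp]
    refine end_ext_posMap fun X => ?_
    simp only [Module.End.mul_apply, posMap_sigmaOp P, posMap_single]
    refine seqOp_comm ?_ ?_ ?_ ?_ _ <;> simp only [ne_eq, Fin.mk.injEq] <;> omega
  | tau_braid h =>
    simp only [map_mul, FreeAlgebra.lift_ι_apply, genOp]
    -- Since σ_1 τ σ_1 is diagonal, it commutes with the diagonal operator τ.
    have h1 := sigmaOp_mul_content_mul_sigmaOp P lam h
    rw [mul_assoc, mul_assoc, ← mul_assoc (sigmaOp q v lam 0 h), tauOp_eq_diagOp, h1,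
      ← map_mul, ← map_mul, mul_comm]
  | tau_comm i hi h =>
    simp only [map_mul, FreeAlgebra.lift_ι_apply, genOp]
    refine end_ext_posMap fun X => ?_
    simp only [Module.End.mul_apply, posMap_sigmaOp P, tauOp_eq_diagOp, posMap_diagOp_content,
      posMap_single]
    refine seqContentOp_comm ?_ ?_ _ <;> simp only [ne_eq, Fin.mk.injEq] <;> omega
  | quadratic i h =>
    simp only [map_pow, map_add, map_smul, map_one, FreeAlgebra.lift_ι_apply, genOp]
    refine end_ext_posMap fun X => ?_
    simp only [sq, Module.End.mul_apply, LinearMap.add_apply, LinearMap.smul_apply,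
      Module.End.one_apply, map_add, map_smul, posMap_sigmaOp P, posMap_single]
    exact seqOp_quadratic hq (X.content_ne P (by simp [Fin.lt_def]) (by simp))
  | cyclotomic h =>
    rw [list_prod_sub_eq_aeval, ← Polynomial.aeval_algHom_apply, map_zero,
      FreeAlgebra.lift_ι_apply]
    exact aeval_tauOp lam h

/-- The representation of `H(m,1,n)` on the space of standard tableaux. -/
noncomputable def tableauRep (P : SemisimpleParameters q v n) (lam : MultiPartition m n) :
    HeckeAlgebra q v n →ₐ[K] Module.End K (TableauSpace K lam) :=
  RingQuot.liftAlgHom K ⟨FreeAlgebra.lift K (genOp q v lam), fun _ _ h => lift_genOp_rel P lam h⟩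

theorem tableauRep_tau (P : SemisimpleParameters q v n) (lam : MultiPartition m n) (h : 0 < n) :
    tableauRep P lam (tau q v h) = tauOp q v lam h := by
  simp [tableauRep, tau, genOp]

theorem tableauRep_sigma (P : SemisimpleParameters q v n) (lam : MultiPartition m n) {i : ℕ}
    (h : i + 1 < n) : tableauRep P lam (sigma q v i h) = sigmaOp q v lam i h := by
  simp [tableauRep, sigma, genOp]

end Representation

/-! ### Counting standard tableaux -/

section Counting

variable {m : ℕ}

noncomputable instance (x y : Cell m) : Decidable (x < y) := Classical.propDecidable _

/-- The nodes which can be removed from a set of nodes. -/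
noncomputable def removable (S : Finset (Cell m)) : Finset (Cell m) :=
  open Classical in S.filter fun y => ∀ z ∈ S, ¬ y < z

/-- The nodes which can be added to a lower set of nodes. -/
noncomputable def addable (S : Finset (Cell m)) : Finset (Cell m) :=
  open Classical in
  (Finset.univ.sigma fun _ => Finset.range (S.card + 1) ×ˢ Finset.range (S.card + 1)).filter
    fun x => x ∉ S ∧ ∀ z, z < x → z ∈ S

theorem mem_removable {S : Finset (Cell m)} {y : Cell m} :
    y ∈ removable S ↔ y ∈ S ∧ ∀ z ∈ S, ¬ y < z := by
  simp [removable]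

theorem isLowerSet_insert {S : Finset (Cell m)} (hS : IsLowerSet (S : Set (Cell m)))
    {x : Cell m} (hx : ∀ z, z < x → z ∈ S) :
    IsLowerSet ((insert x S : Finset (Cell m)) : Set (Cell m)) := by
  intro a b hba ha
  rcases hba.lt_or_eq with hlt | rfl
  · rcases Finset.mem_insert.1 (Finset.mem_coe.1 ha) with rfl | ha
    · exact Finset.mem_coe.2 (Finset.mem_insert_of_mem (hx b hlt))
    · exact Finset.mem_coe.2 (Finset.mem_insert_of_mem (hS hba ha))
  · exact ha

theorem isLowerSet_erase {S : Finset (Cell m)} (hS : IsLowerSet (S : Set (Cell m)))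
    {y : Cell m} (hy : y ∈ removable S) :
    IsLowerSet ((S.erase y : Finset (Cell m)) : Set (Cell m)) := by
  intro a b hba ha
  obtain ⟨hne, haS⟩ := Finset.mem_erase.1 (Finset.mem_coe.1 ha)
  refine Finset.mem_coe.2 (Finset.mem_erase.2 ⟨?_, hS hba haS⟩)
  rintro rfl
  exact (mem_removable.1 hy).2 a haS (lt_of_le_of_ne hba (Ne.symm hne))

/-- The box in the definition, which only ensures finiteness, loses nothing: the hook of an addable
node fits into `S.card + 1` nodes. -/
theorem mem_addable {S : Finset (Cell m)} (hS : IsLowerSet (S : Set (Cell m))) {x : Cell m} :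
    x ∈ addable S ↔ x ∉ S ∧ ∀ z, z < x → z ∈ S := by
  simp only [addable, Finset.mem_filter, Finset.mem_sigma, Finset.mem_univ, true_and,
    Finset.mem_product, Finset.mem_range, and_iff_right_iff_imp]
  rintro ⟨hx, h⟩
  have := hook_card_le (isLowerSet_insert hS h) (Finset.mem_insert_self x S)
    (Finset.mem_insert_self x S)
  rw [Finset.card_insert_of_notMem hx] at this
  omega

theorem removable_insert {S : Finset (Cell m)} (hS : IsLowerSet (S : Set (Cell m))) {x : Cell m}
    (hx : x ∈ addable S) :
    removable (insert x S) = insert x ({y ∈ removable S | ¬ y < x}) := by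
  obtain ⟨hxS, hlow⟩ := (mem_addable hS).1 hx
  ext y
  simp only [mem_removable, Finset.mem_insert, Finset.mem_filter]
  constructor
  · rintro ⟨rfl | hy, h⟩
    · exact Or.inl rfl
    · exact Or.inr ⟨⟨hy, fun z hz => h z (Or.inr hz)⟩, h x (Or.inl rfl)⟩
  · rintro (rfl | ⟨⟨hy, h⟩, hyx⟩)
    · refine ⟨Or.inl rfl, ?_⟩
      rintro z (rfl | hz) hlt
      · exact lt_irrefl _ hlt
      · exact hxS (hS hlt.le hz)
    · refine ⟨Or.inr hy, ?_⟩
      rintro z (rfl | hz)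
      · exact hyx
      · exact h z hz

theorem addable_erase {S : Finset (Cell m)} (hS : IsLowerSet (S : Set (Cell m))) {y : Cell m}
    (hy : y ∈ removable S) :
    addable (S.erase y) = insert y ({x ∈ addable S | ¬ y < x}) := by
  have hE := isLowerSet_erase hS hy
  obtain ⟨hyS, hmax⟩ := mem_removable.1 hy
  ext x
  simp only [mem_addable hE, mem_addable hS, Finset.mem_insert, Finset.mem_filter,
    Finset.mem_erase]
  constructor
  · rintro ⟨h1, h2⟩
    by_cases hxy : x = y
    · exact Or.inl hxy
    · refine Or.inr ⟨⟨fun h => h1 ⟨hxy, h⟩, fun z hz => (h2 z hz).2⟩, fun hlt => ?_⟩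
      exact (h2 y hlt).1 rfl
  · rintro (rfl | ⟨⟨h1, h2⟩, h3⟩)
    · exact ⟨fun h => h.1 rfl, fun z hz => ⟨hz.ne, hS hz.le hyS⟩⟩
    · refine ⟨fun h => h1 h.2, fun z hz => ⟨?_, h2 z hz⟩⟩
      rintro rfl
      exact h3 hz

/-- The `k`-th diagram of a lower set of nodes. -/
def sliceDiagram {S : Finset (Cell m)} (hS : IsLowerSet (S : Set (Cell m))) (k : Fin m) :
    YoungDiagram where
  cells := (S.filter fun x => x.1 = k).image fun x => x.2
  isLowerSet := by
    intro a b hba ha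
    obtain ⟨x, hx, rfl⟩ := Finset.mem_image.1 (Finset.mem_coe.1 ha)
    obtain ⟨hxS, rfl⟩ := Finset.mem_filter.1 hx
    refine Finset.mem_coe.2 (Finset.mem_image.2 ⟨⟨x.1, b⟩, Finset.mem_filter.2 ⟨?_, rfl⟩, rfl⟩)
    exact hS (cell_le_iff.2 ⟨rfl, hba.1, hba.2⟩ : (⟨x.1, b⟩ : Cell m) ≤ x) hxS

theorem mem_sliceDiagram {S : Finset (Cell m)} (hS : IsLowerSet (S : Set (Cell m))) {k : Fin m}
    {c : ℕ × ℕ} : c ∈ sliceDiagram hS k ↔ (⟨k, c⟩ : Cell m) ∈ S := by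
  change c ∈ (S.filter fun x => x.1 = k).image (fun x => x.2) ↔ _
  rw [Finset.mem_image]
  constructor
  · rintro ⟨x, hx, rfl⟩
    obtain ⟨hxS, rfl⟩ := Finset.mem_filter.1 hx
    exact hxS
  · intro h
    exact ⟨⟨k, c⟩, Finset.mem_filter.2 ⟨h, rfl⟩, rfl⟩

theorem mem_iff_lt_rowLen {S : Finset (Cell m)} (hS : IsLowerSet (S : Set (Cell m)))
    {x : Cell m} : x ∈ S ↔ x.2.2 < (sliceDiagram hS x.1).rowLen x.2.1 := by
  rw [← YoungDiagram.mem_iff_lt_rowLen, mem_sliceDiagram]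

theorem mem_addable_iff_rowLen {S : Finset (Cell m)} (hS : IsLowerSet (S : Set (Cell m)))
    {x : Cell m} : x ∈ addable S ↔ x.2.2 = (sliceDiagram hS x.1).rowLen x.2.1 ∧
      (x.2.1 ≠ 0 → (sliceDiagram hS x.1).rowLen x.2.1 <
        (sliceDiagram hS x.1).rowLen (x.2.1 - 1)) := by
  obtain ⟨k, r, s⟩ := x
  have lt_of : ∀ a b : ℕ, a ≤ r → b ≤ s → a + b < r + s →
      (⟨k, (a, b)⟩ : Cell m) < ⟨k, (r, s)⟩ := by
    intro a b h1 h2 h3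
    refine lt_of_le_of_ne (cell_le_iff.2 ⟨rfl, h1, h2⟩) fun e => ?_
    have e1 := congrArg (fun c : Cell m => c.2.1 + c.2.2) e
    dsimp only at e1
    omega
  rw [mem_addable hS, mem_iff_lt_rowLen hS]
  dsimp only
  constructor
  · rintro ⟨h1, h2⟩
    have h3 : s = (sliceDiagram hS k).rowLen r := by
      by_contra hne
      have := h2 ⟨k, (r, s - 1)⟩ (lt_of r (s - 1) le_rfl (by omega) (by omega))
      rw [mem_iff_lt_rowLen hS] at this
      dsimp only at this
      omega
    refine ⟨h3, fun hr => ?_⟩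
    have := h2 ⟨k, (r - 1, s)⟩ (lt_of (r - 1) s (by omega) le_rfl (by omega))
    rw [mem_iff_lt_rowLen hS] at this
    dsimp only at this
    omega
  · rintro ⟨h1, h2⟩
    refine ⟨by omega, ?_⟩
    rintro ⟨l, a, b⟩ hz
    obtain ⟨h3, h4, h5⟩ := cell_le_iff.1 hz.le
    dsimp only at h3 h4 h5
    subst h3
    rw [mem_iff_lt_rowLen hS]
    dsimp only
    rcases h4.lt_or_eq with h4 | rfl
    · have := (sliceDiagram hS l).rowLen_anti a (r - 1) (by omega)
      have := h2 (by omega)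
      omega
    · have : b ≠ s := by
        rintro rfl
        exact lt_irrefl _ hz
      omega

theorem mem_removable_iff_rowLen {S : Finset (Cell m)} (hS : IsLowerSet (S : Set (Cell m)))
    {x : Cell m} : x ∈ removable S ↔ x.2.2 + 1 = (sliceDiagram hS x.1).rowLen x.2.1 ∧
      (sliceDiagram hS x.1).rowLen (x.2.1 + 1) < (sliceDiagram hS x.1).rowLen x.2.1 := by
  obtain ⟨k, r, s⟩ := x
  have lt_of : ∀ a b : ℕ, r ≤ a → s ≤ b → r + s < a + b →
      (⟨k, (r, s)⟩ : Cell m) < ⟨k, (a, b)⟩ := by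
    intro a b h1 h2 h3
    refine lt_of_le_of_ne (cell_le_iff.2 ⟨rfl, h1, h2⟩) fun e => ?_
    have e1 := congrArg (fun c : Cell m => c.2.1 + c.2.2) e
    dsimp only at e1
    omega
  rw [mem_removable, mem_iff_lt_rowLen hS]
  dsimp only
  constructor
  · rintro ⟨h1, h2⟩
    have h3 : (⟨k, (r, s + 1)⟩ : Cell m) ∉ S := fun h =>
      h2 _ h (lt_of r (s + 1) le_rfl (by omega) (by omega))
    have h4 : (⟨k, (r + 1, s)⟩ : Cell m) ∉ S := fun h =>
      h2 _ h (lt_of (r + 1) s (by omega) le_rfl (by omega))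
    rw [mem_iff_lt_rowLen hS] at h3 h4
    dsimp only at h3 h4
    omega
  · rintro ⟨h1, h2⟩
    refine ⟨by omega, ?_⟩
    rintro ⟨l, a, b⟩ hz hlt
    obtain ⟨h3, h4, h5⟩ := cell_le_iff.1 hlt.le
    dsimp only at h3 h4 h5
    subst h3
    rw [mem_iff_lt_rowLen hS] at hz
    dsimp only at hz
    rcases h4.lt_or_eq with h4 | rfl
    · have := (sliceDiagram hS k).rowLen_anti (r + 1) a (by omega)
      omega
    · have : s ≠ b := by
        rintro rfl
        exact lt_irrefl _ hlt
      omega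

/-- There are `m` more addable than removable nodes. -/
theorem card_addable {S : Finset (Cell m)} (hS : IsLowerSet (S : Set (Cell m))) :
    (addable S).card = (removable S).card + m := by
  have hc : ((removable S).disjSum (Finset.univ : Finset (Fin m))).card =
      (removable S).card + m := by simp
  rw [← hc]
  -- An addable node in row r > 0 goes to the removable end of row r - 1; the addable node in row 0
  -- goes to the index of its diagram, which accounts for the extra m.
  refine Finset.card_bij'
    (fun x _ => if x.2.1 = 0 then Sum.inr x.1 else
      Sum.inl ⟨x.1, (x.2.1 - 1, (sliceDiagram hS x.1).rowLen (x.2.1 - 1) - 1)⟩)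
    (fun z _ => Sum.elim
      (fun y : Cell m => ⟨y.1, (y.2.1 + 1, (sliceDiagram hS y.1).rowLen (y.2.1 + 1))⟩)
      (fun k => ⟨k, (0, (sliceDiagram hS k).rowLen 0)⟩) z) ?_ ?_ ?_ ?_
  · rintro ⟨k, r, s⟩ hx
    rw [mem_addable_iff_rowLen hS] at hx
    dsimp only at hx ⊢
    split_ifs with h0
    · simp
    · rw [Finset.inl_mem_disjSum, mem_removable_iff_rowLen hS]
      dsimp only
      have := hx.2 h0
      rw [Nat.sub_add_cancel (by omega : 1 ≤ r)]
      omega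
  · rintro (⟨k, r, s⟩ | k) hz
    · rw [Finset.inl_mem_disjSum, mem_removable_iff_rowLen hS] at hz
      rw [mem_addable_iff_rowLen hS]
      dsimp only [Sum.elim_inl] at hz ⊢
      exact ⟨rfl, fun _ => hz.2⟩
    · rw [mem_addable_iff_rowLen hS]
      exact ⟨rfl, fun h => absurd rfl h⟩
  · rintro ⟨k, r, s⟩ hx
    rw [mem_addable_iff_rowLen hS] at hx
    dsimp only at hx ⊢
    split_ifs with h0
    · subst h0
      rw [hx.1]
      rfl
    · rw [hx.1]
      simp only [Sum.elim_inl]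
      rw [Nat.sub_add_cancel (by omega : 1 ≤ r)]
  · rintro (⟨k, r, s⟩ | k) hz
    · rw [Finset.inl_mem_disjSum, mem_removable_iff_rowLen hS] at hz
      dsimp only at hz
      simp [← hz.1]
    · simp

/-- The number of ways to remove `k` nodes from `S` one by one. -/
noncomputable def pathCount : ℕ → Finset (Cell m) → ℕ
  | 0, _ => 1
  | k + 1, S => ∑ y ∈ removable S, pathCount k (S.erase y)

theorem card_erase_of_mem_removable {S : Finset (Cell m)} {k : ℕ} (hk : S.card = k + 1)
    {y : Cell m} (hy : y ∈ removable S) : (S.erase y).card = k := by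
  rw [Finset.card_erase_of_mem (mem_removable.1 hy).1, hk, Nat.add_sub_cancel]

theorem insert_erase_comm {S : Finset (Cell m)} {x y : Cell m} (hxy : x ≠ y) :
    (insert x S).erase y = insert x (S.erase y) :=
  Finset.erase_insert_of_ne hxy

/-- Adding x and then removing y gives S back when y = x; the other pairs can be done in the
opposite order. The two kinds of trivial pairs differ in number by m, so each induction step
contributes one more m. -/
theorem sum_pathCount_insert (k : ℕ) : ∀ {S : Finset (Cell m)},
    IsLowerSet (S : Set (Cell m)) → S.card = k →
      ∑ x ∈ addable S, pathCount (k + 1) (insert x S) = m * (k + 1) * pathCount k S := by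
  have expand : ∀ (k : ℕ) {S : Finset (Cell m)}, IsLowerSet (S : Set (Cell m)) →
      ∑ x ∈ addable S, pathCount (k + 1) (insert x S) = (addable S).card * pathCount k S +
        ∑ x ∈ addable S, ∑ y ∈ removable S with ¬ y < x, pathCount k ((insert x S).erase y) := by
    intro k S hS
    rw [← smul_eq_mul, ← Finset.sum_const, ← Finset.sum_add_distrib]
    refine Finset.sum_congr rfl fun x hx => ?_
    have hxS := ((mem_addable hS).1 hx).1
    rw [pathCount, removable_insert hS hx, Finset.sum_insert, Finset.erase_insert hxS]
    intro h
    exact hxS (mem_removable.1 (Finset.mem_filter.1 h).1).1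
  induction k with
  | zero =>
    intro S hS hk
    rw [expand 0 hS, card_addable hS]
    have : removable S = ∅ := by
      rw [Finset.card_eq_zero.1 hk]
      rfl
    simp [this]
  | succ k ih =>
    intro S hS hk
    -- The induction hypothesis for `S.erase y`, with the summand for adding y back split off.
    have h1 : ∀ y ∈ removable S, pathCount (k + 1) S +
        ∑ x ∈ addable S with ¬ y < x, pathCount (k + 1) ((insert x S).erase y) =
        m * (k + 1) * pathCount k (S.erase y) := by
      intro y hy
      rw [← ih (isLowerSet_erase hS hy) (card_erase_of_mem_removable hk hy),
        addable_erase hS hy, Finset.sum_insert, Finset.insert_erase (mem_removable.1 hy).1]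
      · congr 1
        refine Finset.sum_congr rfl fun x hx => ?_
        rw [insert_erase_comm]
        rintro rfl
        exact ((mem_addable hS).1 (Finset.mem_filter.1 hx).1).1 (mem_removable.1 hy).1
      · intro h
        exact ((mem_addable hS).1 (Finset.mem_filter.1 h).1).1 (mem_removable.1 hy).1
    have h2 := Finset.sum_congr rfl h1
    rw [Finset.sum_add_distrib, Finset.sum_const, smul_eq_mul, ← Finset.mul_sum] at h2
    have h3 : ∑ x ∈ addable S, ∑ y ∈ removable S with ¬ y < x,
        pathCount (k + 1) ((insert x S).erase y) =
        ∑ y ∈ removable S, ∑ x ∈ addable S with ¬ y < x,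
        pathCount (k + 1) ((insert x S).erase y) := by
      simp only [Finset.sum_filter]
      exact Finset.sum_comm
    have h4 : ∑ y ∈ removable S, pathCount k (S.erase y) = pathCount (k + 1) S := rfl
    rw [h4] at h2
    rw [expand (k + 1) hS, card_addable hS, h3]
    have : ((removable S).card + m) * pathCount (k + 1) S =
      (removable S).card * pathCount (k + 1) S + m * pathCount (k + 1) S := by ring
    rw [this, add_right_comm, h2]
    ring

/-- The sets of nodes of the `m`-partitions of `n`. -/
noncomputable def shapes (m n : ℕ) : Finset (Finset (Cell m)) :=
  (Finset.univ : Finset (MultiPartition m n)).map ⟨cellsOf, cellsOf_injective⟩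

theorem mem_shapes {n : ℕ} {S : Finset (Cell m)} :
    S ∈ shapes m n ↔ IsLowerSet (S : Set (Cell m)) ∧ S.card = n := by
  simp only [shapes, Finset.mem_map, Finset.mem_univ, true_and, Function.Embedding.coeFn_mk]
  constructor
  · rintro ⟨lam, rfl⟩
    exact ⟨isLowerSet_cellsOf lam, card_cellsOf lam⟩
  · rintro ⟨hS, hc⟩
    have hcells : (Finset.univ.sigma fun k => (sliceDiagram hS k).cells) = S := by
      ext x
      rw [Finset.mem_sigma]
      exact ⟨fun h => (mem_sliceDiagram hS).1 h.2,
        fun h => ⟨Finset.mem_univ _, (mem_sliceDiagram hS).2 h⟩⟩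
    refine ⟨⟨sliceDiagram hS, ?_⟩, hcells⟩
    rw [← hc]
    conv_rhs => rw [← hcells]
    rw [Finset.card_sigma]

/-- One factor of each square is expanded over removable nodes. Reindexing the pairs (T, y) as (S,
x) with x addable to S lets `sum_pathCount_insert` evaluate the inner sum. -/
theorem sum_shapes_pathCount_sq (m n : ℕ) :
    ∑ S ∈ shapes m n, pathCount n S ^ 2 = n.factorial * m ^ n := by
  induction n with
  | zero =>
    have : shapes m 0 = {∅} := by
      ext S
      rw [mem_shapes, Finset.mem_singleton, Finset.card_eq_zero]
      constructor
      · exact fun h => h.2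
      · rintro rfl
        exact ⟨by simp [isLowerSet_empty], rfl⟩
    simp [this, pathCount]
  | succ n ih =>
    have h1 : ∑ T ∈ shapes m (n + 1), pathCount (n + 1) T ^ 2 =
        ∑ T ∈ shapes m (n + 1), ∑ y ∈ removable T,
          pathCount (n + 1) T * pathCount n (T.erase y) := by
      refine Finset.sum_congr rfl fun T _ => ?_
      rw [← Finset.mul_sum, sq]
      rfl
    have h2 : ∑ T ∈ shapes m (n + 1), ∑ y ∈ removable T,
          pathCount (n + 1) T * pathCount n (T.erase y) =
        ∑ S ∈ shapes m n, ∑ x ∈ addable S,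
          pathCount (n + 1) (insert x S) * pathCount n S := by
      rw [Finset.sum_sigma', Finset.sum_sigma']
      refine Finset.sum_bij' (fun p _ => ⟨p.1.erase p.2, p.2⟩) (fun p _ => ⟨insert p.2 p.1, p.2⟩)
        ?_ ?_ ?_ ?_ ?_
      · rintro ⟨T, y⟩ h
        obtain ⟨hT, hy⟩ := Finset.mem_sigma.1 h
        obtain ⟨hl, hc⟩ := mem_shapes.1 hT
        refine Finset.mem_sigma.2 ⟨mem_shapes.2 ⟨isLowerSet_erase hl hy,
          card_erase_of_mem_removable hc hy⟩, ?_⟩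
        dsimp only
        rw [addable_erase hl hy]
        exact Finset.mem_insert_self _ _
      · rintro ⟨S, x⟩ h
        obtain ⟨hS, hx⟩ := Finset.mem_sigma.1 h
        obtain ⟨hl, hc⟩ := mem_shapes.1 hS
        have hx' := (mem_addable hl).1 hx
        refine Finset.mem_sigma.2 ⟨mem_shapes.2 ⟨isLowerSet_insert hl hx'.2, ?_⟩, ?_⟩
        · rw [Finset.card_insert_of_notMem hx'.1, hc]
        · dsimp only
          rw [removable_insert hl hx]
          exact Finset.mem_insert_self _ _
      · rintro ⟨T, y⟩ h
        obtain ⟨hT, hy⟩ := Finset.mem_sigma.1 h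
        dsimp only
        rw [Finset.insert_erase (mem_removable.1 hy).1]
      · rintro ⟨S, x⟩ h
        obtain ⟨hS, hx⟩ := Finset.mem_sigma.1 h
        dsimp only
        rw [Finset.erase_insert ((mem_addable (mem_shapes.1 hS).1).1 hx).1]
      · rintro ⟨T, y⟩ h
        obtain ⟨hT, hy⟩ := Finset.mem_sigma.1 h
        dsimp only
        rw [Finset.insert_erase (mem_removable.1 hy).1]
    have h3 : ∀ S ∈ shapes m n, ∑ x ∈ addable S,
        pathCount (n + 1) (insert x S) * pathCount n S =
        m * (n + 1) * pathCount n S ^ 2 := by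
      intro S hS
      obtain ⟨hl, hc⟩ := mem_shapes.1 hS
      rw [← Finset.sum_mul, sum_pathCount_insert n hl hc]
      ring
    rw [h1, h2, Finset.sum_congr rfl h3, ← Finset.mul_sum, ih, Nat.factorial_succ]
    ring

theorem pathCount_pos (k : ℕ) : ∀ {S : Finset (Cell m)}, S.card = k → 0 < pathCount k S := by
  induction k with
  | zero => intro S _; exact Nat.one_pos
  | succ k ih =>
    intro S hk
    obtain ⟨y, hy⟩ := S.exists_maximal (Finset.card_pos.1 (by omega))
    have hyr : y ∈ removable S :=
      mem_removable.2 ⟨hy.1, fun z hz hlt => hlt.not_ge (hy.2 hz hlt.le)⟩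
    exact Finset.sum_pos (fun z hz => ih (card_erase_of_mem_removable hk hz)) ⟨y, hyr⟩

open Classical in
/-- The enumerations of elements of `S` which are compatible with the order. -/
noncomputable def linearExtensions (n : ℕ) (S : Finset (Cell m)) : Finset (Fin n → Cell m) :=
  (Fintype.piFinset fun _ => S).filter fun p =>
    Function.Injective p ∧ ∀ i j, p i ≤ p j → i ≤ j

theorem mem_linearExtensions {n : ℕ} {S : Finset (Cell m)} {p : Fin n → Cell m} :
    p ∈ linearExtensions n S ↔
      (∀ i, p i ∈ S) ∧ Function.Injective p ∧ ∀ i j, p i ≤ p j → i ≤ j := by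
  simp [linearExtensions]

theorem snoc_mem_linearExtensions {n : ℕ} {S : Finset (Cell m)} {p : Fin n → Cell m}
    {y : Cell m} (hy : y ∈ removable S) (hp : p ∈ linearExtensions n (S.erase y)) :
    (Fin.snoc p y : Fin (n + 1) → Cell m) ∈ linearExtensions (n + 1) S := by
  obtain ⟨h1, h2, h3⟩ := mem_linearExtensions.1 hp
  obtain ⟨hyS, hmax⟩ := mem_removable.1 hy
  have hne : ∀ i, p i ≠ y := fun i => (Finset.mem_erase.1 (h1 i)).1
  have hmem : ∀ i, p i ∈ S := fun i => (Finset.mem_erase.1 (h1 i)).2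
  refine mem_linearExtensions.2 ⟨?_, ?_, ?_⟩
  · intro i
    refine Fin.lastCases ?_ (fun i => ?_) i
    · simpa using hyS
    · simpa using hmem i
  · exact Fin.snoc_injective_iff.2 ⟨h2, fun ⟨i, hi⟩ => hne i hi⟩
  · intro i j
    refine Fin.lastCases ?_ (fun j => ?_) j
    · exact fun _ => Fin.le_last i
    · refine Fin.lastCases ?_ (fun i => ?_) i
      · intro h
        simp only [Fin.snoc_last, Fin.snoc_castSucc] at h
        exact absurd (lt_of_le_of_ne h (hne j).symm) (hmax _ (hmem j))
      · intro h
        simp only [Fin.snoc_castSucc] at h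
        exact Fin.castSucc_le_castSucc_iff.2 (h3 i j h)

/-- The node removed first is the last one of the enumeration. Only this inequality is needed, since
the other bounds close the squeeze. -/
theorem pathCount_le_card_linearExtensions (n : ℕ) : ∀ (S : Finset (Cell m)),
    pathCount n S ≤ (linearExtensions n S).card := by
  induction n with
  | zero =>
    intro S
    rw [pathCount, Nat.succ_le_iff, Finset.card_pos]
    exact ⟨Fin.elim0, mem_linearExtensions.2 ⟨fun i => i.elim0, fun i => i.elim0,
      fun i => i.elim0⟩⟩
  | succ n ih =>
    intro S
    calc pathCount (n + 1) S
        ≤ ∑ y ∈ removable S, (linearExtensions n (S.erase y)).card :=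
          Finset.sum_le_sum fun y _ => ih (S.erase y)
      _ = ((removable S).sigma fun y => linearExtensions n (S.erase y)).card :=
          (Finset.card_sigma _ _).symm
      _ ≤ (linearExtensions (n + 1) S).card := by
          refine Finset.card_le_card_of_injOn
            (fun z => (Fin.snoc z.2 z.1 : Fin (n + 1) → Cell m)) ?_ ?_
          · rintro ⟨y, p⟩ h
            obtain ⟨hy, hp⟩ := Finset.mem_sigma.1 (Finset.mem_coe.1 h)
            exact snoc_mem_linearExtensions hy hp
          · rintro ⟨y, p⟩ - ⟨z, r⟩ - h
            dsimp only at h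
            obtain ⟨rfl, rfl⟩ := Fin.snoc_inj.1 h
            rfl

theorem pathCount_le_card {n : ℕ} (lam : MultiPartition m n) :
    pathCount n (cellsOf lam) ≤ Fintype.card (StandardTableau lam) := by
  refine (pathCount_le_card_linearExtensions n _).trans ?_
  rw [← Finset.card_univ]
  classical
  refine le_trans (Finset.card_le_card (t := Finset.univ.image
    fun X : StandardTableau lam => X.pos) ?_) Finset.card_image_le
  intro p hp
  obtain ⟨h1, h2, h3⟩ := mem_linearExtensions.1 hp
  obtain ⟨X, hX⟩ := StandardTableau.exists_pos_eq_of_forall h2 h1 h3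
  exact Finset.mem_image.2 ⟨X, Finset.mem_univ _, hX⟩

instance {n : ℕ} (lam : MultiPartition m n) : Nonempty (StandardTableau lam) :=
  Fintype.card_pos_iff.1
    ((pathCount_pos n (card_cellsOf lam)).trans_le (pathCount_le_card lam))

/-- There are at least `n! mⁿ` pairs of standard tableaux of the same shape. -/
theorem factorial_mul_pow_le_sum_card_sq (m n : ℕ) :
    n.factorial * m ^ n ≤
      ∑ lam : MultiPartition m n, Fintype.card (StandardTableau lam) ^ 2 := by
  rw [← sum_shapes_pathCount_sq, shapes, Finset.sum_map]
  exact Finset.sum_le_sum fun lam _ => Nat.pow_le_pow_left (pathCount_le_card lam) 2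

end Counting

/-! ### Connectedness of the set of standard tableaux -/

namespace StandardTableau

variable {m n : ℕ} {lam : MultiPartition m n}

/-- If the positions of `i` and `i + 1` are incomparable, they can be exchanged. -/
theorem exists_swap (X : StandardTableau lam) {i : ℕ} (h : i + 1 < n)
    (hX : ¬ X.pos ⟨i, by omega⟩ < X.pos ⟨i + 1, h⟩) :
    ∃ Y : StandardTableau lam, Y.pos = X.pos ∘ Equiv.swap ⟨i, by omega⟩ ⟨i + 1, h⟩ :=
  ⟨⟨_, (X.swap_isStandard_iff h).2 hX⟩, rfl⟩

theorem toLinearExtension_lt {x y : Cell m} (h : x < y) :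
    toLinearExtension x < toLinearExtension y :=
  lt_of_le_of_ne (toLinearExtension.monotone h.le) fun e => h.ne e

/-- A nonempty set of tableaux which is closed under exchanging `i` and `i + 1` contains a tableau
whose positions are sorted with respect to a linear extension of the order. -/
theorem exists_sorted {C : StandardTableau lam → Prop}
    (hC : ∀ (X Y : StandardTableau lam) (i : ℕ) (h : i + 1 < n),
      Y.pos = X.pos ∘ Equiv.swap ⟨i, by omega⟩ ⟨i + 1, h⟩ → C X → C Y)
    (hne : ∃ X, C X) :
    ∃ Z, C Z ∧ StrictMono fun i => toLinearExtension (Z.pos i) := by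
  -- The lexicographically least sequence of positions: at a descent the exchange is standard and
  -- would make it smaller.
  obtain ⟨Z, hZ, hmin⟩ := Set.exists_min_image {X | C X}
    (fun X => toLex fun i => toLinearExtension (X.pos i)) (Set.toFinite _) hne
  refine ⟨Z, hZ, ?_⟩
  have hstep : ∀ (i : ℕ) (h : i + 1 < n),
      toLinearExtension (Z.pos ⟨i, by omega⟩) < toLinearExtension (Z.pos ⟨i + 1, h⟩) := by
    intro i h
    by_contra hlt
    have hnlt : ¬ Z.pos ⟨i, by omega⟩ < Z.pos ⟨i + 1, h⟩ := fun hl =>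
      hlt (toLinearExtension_lt hl)
    obtain ⟨Y, hY⟩ := Z.exists_swap h hnlt
    refine absurd (hmin Y (hC Z Y i h hY hZ)) (not_le.2 ?_)
    refine ⟨⟨i, by omega⟩, fun j hj => ?_, ?_⟩
    · change toLinearExtension (Y.pos j) = toLinearExtension (Z.pos j)
      rw [hY, Function.comp_apply, Equiv.swap_apply_of_ne_of_ne hj.ne]
      rintro rfl
      have : i + 1 < i := hj
      omega
    · change toLinearExtension (Y.pos ⟨i, by omega⟩) < toLinearExtension (Z.pos ⟨i, by omega⟩)
      rw [hY, Function.comp_apply, Equiv.swap_apply_left]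
      refine lt_of_le_of_ne (not_lt.1 hlt) fun e => ?_
      have := Z.pos_injective (e : Z.pos ⟨i + 1, h⟩ = Z.pos ⟨i, by omega⟩)
      simp at this
  cases n with
  | zero => exact fun i => i.elim0
  | succ n => exact Fin.strictMono_iff_lt_succ.2 fun i => hstep i.1 (by omega)

theorem eq_of_sorted {X Y : StandardTableau lam}
    (hX : StrictMono fun i => toLinearExtension (X.pos i))
    (hY : StrictMono fun i => toLinearExtension (Y.pos i)) : X = Y := by
  refine eq_of_pos_eq ((StrictMono.range_inj hX hY).1 ?_)
  have h : ∀ Z : StandardTableau lam, Set.range Z.pos = cellsOf lam := by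
    intro Z
    ext x
    constructor
    · rintro ⟨i, rfl⟩
      exact Z.pos_mem i
    · exact fun hx => Z.exists_pos_eq hx
  exact (h X).trans (h Y).symm

/-- A property of tableaux of a given shape which is preserved by exchanging `i` and `i + 1` holds
for all of them if it holds for one. -/
theorem swap_induction {C : StandardTableau lam → Prop}
    (hC : ∀ (X Y : StandardTableau lam) (i : ℕ) (h : i + 1 < n),
      Y.pos = X.pos ∘ Equiv.swap ⟨i, by omega⟩ ⟨i + 1, h⟩ → C X → C Y)
    {X : StandardTableau lam} (hX : C X) (Y : StandardTableau lam) : C Y := by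
  -- Otherwise C and its complement, both closed under exchanges, would each contain the unique
  -- sorted tableau.
  by_contra hY
  obtain ⟨Z, hZ, hs⟩ := exists_sorted hC ⟨X, hX⟩
  obtain ⟨Z', hZ', hs'⟩ := exists_sorted (C := fun X => ¬ C X)
    (fun X Y i h hXY hnX hY => hnX (hC Y X i h (by rw [hXY, comp_swap_comp_swap]) hY))
    ⟨Y, hY⟩
  rw [eq_of_sorted hs hs'] at hZ
  exact hZ' hZ

end StandardTableau

/-! ### The image of the Hecke algebra in the product of the matrix algebras -/

section Separating

variable {K T : Type*} [Field K] [Fintype T]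

/-- A subalgebra of the functions on a finite set which separates points contains all
functions. -/
theorem subalgebra_eq_top_of_separates (D : Subalgebra K (T → K))
    (h : ∀ x y : T, x ≠ y → ∃ f ∈ D, f x ≠ f y) : D = ⊤ := by
  classical
  have hind : ∀ x, Pi.single x (1 : K) ∈ D := by
    intro x
    choose! f hfD hf using h x
    -- Lagrange interpolation: the factor for y is 1 at x and 0 at y.
    have hprod : ∏ y ∈ Finset.univ.erase x,
        ((f y x - f y y)⁻¹ • (f y - algebraMap K (T → K) (f y y))) ∈ D :=
      Subalgebra.prod_mem _ fun y hy => D.smul_mem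
        (D.sub_mem (hfD y (Finset.ne_of_mem_erase hy).symm) (D.algebraMap_mem _)) _
    convert hprod using 1
    funext z
    rw [Finset.prod_apply]
    by_cases hz : z = x
    · subst hz
      rw [Pi.single_eq_same, Finset.prod_eq_one]
      intro y hy
      have := sub_ne_zero.2 (hf y (Finset.ne_of_mem_erase hy).symm)
      simp [this]
    · rw [Pi.single_eq_of_ne hz]
      refine (Finset.prod_eq_zero (Finset.mem_erase.2 ⟨hz, Finset.mem_univ z⟩) ?_).symm
      simp
  refine Algebra.eq_top_iff.2 fun g => ?_
  have : g = ∑ x, g x • Pi.single x (1 : K) := by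
    funext z
    rw [Finset.sum_apply, Finset.sum_eq_single z]
    · simp
    · intro y _ hy
      simp [Pi.single_eq_of_ne (Ne.symm hy)]
    · simp
  rw [this]
  exact Subalgebra.sum_mem _ fun x _ => D.smul_mem (hind x) _

end Separating

/-! ### Surjectivity onto the product of matrix algebras -/

section Surjectivity

variable {K : Type*} [Field K] {m n : ℕ} {q : K} {v : Fin m → K}

/-- All representations on standard tableaux together. -/
noncomputable def totalRep (P : SemisimpleParameters q v n) :
    HeckeAlgebra q v n →ₐ[K] ((lam : MultiPartition m n) → Module.End K (TableauSpace K lam)) :=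
  AlgHom.pi fun lam => tableauRep P lam

theorem totalRep_apply (P : SemisimpleParameters q v n) (x : HeckeAlgebra q v n)
    (lam : MultiPartition m n) : totalRep P x lam = tableauRep P lam x := rfl

/-- The diagonal operators on all spaces of tableaux. -/
noncomputable def totalDiag (K : Type*) [Field K] (m n : ℕ) :
    ((Σ lam : MultiPartition m n, StandardTableau lam) → K) →ₐ[K]
      ((lam : MultiPartition m n) → Module.End K (TableauSpace K lam)) :=
  AlgHom.pi fun lam => (diagOp K lam).comp
    (AlgHom.pi fun X => Pi.evalAlgHom K _ ⟨lam, X⟩)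

theorem totalDiag_apply (g : (Σ lam : MultiPartition m n, StandardTableau lam) → K)
    (lam : MultiPartition m n) : totalDiag K m n g lam = diagOp K lam fun X => g ⟨lam, X⟩ := rfl

theorem totalDiag_content_mem_range (P : SemisimpleParameters q v n) (i : ℕ) (h : i < n) :
    totalDiag K m n (fun X => content q v X.2 ⟨i, h⟩) ∈ (totalRep P).range := by
  induction i with
  | zero =>
    refine ⟨tau q v h, funext fun lam => ?_⟩
    exact tableauRep_tau P lam h
  | succ i ih =>
    obtain ⟨x, hx⟩ := ih (by omega)
    refine ⟨sigma q v i h * x * sigma q v i h, funext fun lam => ?_⟩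
    have hx' : tableauRep P lam x = diagOp K lam fun X => content q v X ⟨i, by omega⟩ :=
      congrFun hx lam
    change totalRep P _ lam = _
    rw [totalRep_apply, map_mul, map_mul, tableauRep_sigma, hx',
      sigmaOp_mul_content_mul_sigmaOp P, totalDiag_apply]

/-- The diagonal functions in the image form a subalgebra containing all contents. Contents separate
tableaux, even across shapes. -/
theorem totalDiag_mem_range (P : SemisimpleParameters q v n)
    (g : (Σ lam : MultiPartition m n, StandardTableau lam) → K) :
    totalDiag K m n g ∈ (totalRep P).range := by
  have htop : (totalRep P).range.comap (totalDiag K m n) = ⊤ := by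
    refine subalgebra_eq_top_of_separates _ ?_
    rintro ⟨lam, X⟩ ⟨mu, Y⟩ hne
    by_contra hcon
    push Not at hcon
    refine hne (StandardTableau.sigma_eq_of_pos_eq (X.pos_eq_of_content_eq P Y fun i => ?_))
    exact hcon _ (totalDiag_content_mem_range P i.1 i.2)
  have : g ∈ (totalRep P).range.comap (totalDiag K m n) := by rw [htop]; trivial
  exact this

/-- The operator which maps `w` to the coefficient of `Y` in `w` times `u`. -/
noncomputable def coeffOp {lam : MultiPartition m n} (u : TableauSpace K lam)
    (Y : StandardTableau lam) : Module.End K (TableauSpace K lam) :=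
  (Finsupp.lapply Y : TableauSpace K lam →ₗ[K] K).smulRight u

theorem coeffOp_apply {lam : MultiPartition m n} (u : TableauSpace K lam)
    (Y : StandardTableau lam) (w : TableauSpace K lam) : coeffOp u Y w = w Y • u := rfl

theorem mul_coeffOp {lam : MultiPartition m n} (f : Module.End K (TableauSpace K lam))
    (u : TableauSpace K lam) (Y : StandardTableau lam) : f * coeffOp u Y = coeffOp (f u) Y := by
  refine LinearMap.ext fun w => ?_
  rw [Module.End.mul_apply, coeffOp_apply, coeffOp_apply, map_smul]

open Classical in
theorem diagOp_single_apply {lam : MultiPartition m n} (X : StandardTableau lam)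
    (w : TableauSpace K lam) :
    diagOp K lam (Pi.single X 1) w = w X • Finsupp.single X (1 : K) := by
  have : diagOp K lam (Pi.single X 1) = coeffOp (Finsupp.single X (1 : K)) X := by
    refine Finsupp.lhom_ext' fun Y => LinearMap.ext_ring ?_
    change diagOp K lam (Pi.single X 1) (Finsupp.single Y 1) =
      coeffOp (Finsupp.single X (1 : K)) X (Finsupp.single Y 1)
    rw [diagOp_single, coeffOp_apply]
    by_cases h : Y = X
    · subst h; simp
    · simp [h]
  rw [this, coeffOp_apply]

open Classical in
theorem totalDiag_single {lam : MultiPartition m n} (X : StandardTableau lam) :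
    totalDiag K m n (Pi.single ⟨lam, X⟩ 1) = Pi.single lam (diagOp K lam (Pi.single X 1)) := by
  funext mu
  rw [totalDiag_apply]
  by_cases h : mu = lam
  · subst h
    rw [Pi.single_eq_same]
    congr 1
    funext Y
    by_cases hY : Y = X
    · subst hY; simp
    · rw [Pi.single_eq_of_ne hY, Pi.single_eq_of_ne]
      intro e
      exact hY (eq_of_heq (Sigma.mk.inj e).2)
  · rw [Pi.single_eq_of_ne h]
    convert map_zero (diagOp K mu) with Y
    rw [Pi.single_eq_of_ne, Pi.zero_apply]
    intro e
    exact h (Sigma.mk.inj e).1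

open Classical in
theorem mul_pi_single {lam : MultiPartition m n}
    (f : (lam : MultiPartition m n) → Module.End K (TableauSpace K lam))
    (g : Module.End K (TableauSpace K lam)) :
    f * Pi.single lam g = Pi.single lam (f lam * g) := by
  funext mu
  by_cases h : mu = lam
  · subst h; simp
  · simp [Pi.single_eq_of_ne h]

open Classical in
/-- The matrix units lie in the image of the Hecke algebra. -/
theorem matrixUnit_mem_range (P : SemisimpleParameters q v n) {lam : MultiPartition m n}
    (X Y : StandardTableau lam) :
    (Pi.single lam (coeffOp (Finsupp.single X (1 : K)) Y) :
      (lam : MultiPartition m n) → Module.End K (TableauSpace K lam)) ∈ (totalRep P).range := by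
  have hdiag : ∀ Z : StandardTableau lam,
      (Pi.single lam (diagOp K lam (Pi.single Z 1)) :
        (lam : MultiPartition m n) → Module.End K (TableauSpace K lam)) ∈
        (totalRep P).range := fun Z => by
    rw [← totalDiag_single]
    exact totalDiag_mem_range P _
  refine StandardTableau.swap_induction (C := fun X =>
    (Pi.single lam (coeffOp (Finsupp.single X (1 : K)) Y) :
      (lam : MultiPartition m n) → Module.End K (TableauSpace K lam)) ∈ (totalRep P).range)
    ?_ (X := Y) ?_ X
  · intro X X' i h hX' hX
    have hs : IsStandard lam (X.entry.trans (Equiv.swap ⟨i, by omega⟩ ⟨i + 1, h⟩)) := by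
      have h1 := X'.standard
      have h2 : X'.entry = X.entry.trans (Equiv.swap ⟨i, by omega⟩ ⟨i + 1, h⟩) :=
        eq_of_posOf_eq hX'
      rwa [h2] at h1
    have hXX' : X' = ⟨_, hs⟩ := StandardTableau.eq_of_pos_eq hX'
    have hnadj := (not_congr (X.content_adjacent_iff P h)).2 ((X.swap_isStandard_iff h).1 hs)
    have hcne : content q v X ⟨i, by omega⟩ ≠ content q v X ⟨i + 1, h⟩ :=
      X.content_ne P (by simp [Fin.lt_def]) (by simp)
    have hXne : X ≠ X' := by
      intro e
      have h1 := congrFun hX' ⟨i, by omega⟩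
      rw [← e, Function.comp_apply, Equiv.swap_apply_left] at h1
      have := X.pos_injective h1
      simp at this
    set c := (q * content q v X ⟨i + 1, h⟩ - q⁻¹ * content q v X ⟨i, by omega⟩) /
        (content q v X ⟨i + 1, h⟩ - content q v X ⟨i, by omega⟩) with hc
    have hc0 : c ≠ 0 := by
      refine div_ne_zero (fun h0 => ?_) (sub_ne_zero.2 hcne.symm)
      refine hnadj (Or.inr ?_)
      have hq := P.q_ne_zero
      have h1 : q * (q * content q v X ⟨i + 1, h⟩ - q⁻¹ * content q v X ⟨i, by omega⟩) = 0 := by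
        rw [h0, mul_zero]
      rw [mul_sub, ← mul_assoc, ← mul_assoc, mul_inv_cancel₀ hq, one_mul, ← sq] at h1
      exact (sub_eq_zero.1 h1).symm
    -- In matrix units: E_{X'X'} σ_i E_{XY} = c E_{X'Y}, with c ≠ 0 because the contents are not
    -- adjacent.
    have hprod := (totalRep P).range.mul_mem (hdiag X')
      ((totalRep P).range.mul_mem ((totalRep P).mem_range_self (sigma q v i h)) hX)
    rw [mul_pi_single, mul_pi_single, mul_coeffOp, mul_coeffOp, Pi.single_eq_same,
      totalRep_apply, tableauRep_sigma, sigmaOp_single, swapVector, dif_pos hs,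
      ← hXX', diagOp_single_apply, ← hc] at hprod
    have hcoef : ((-((q - q⁻¹) * (content q v X ⟨i + 1, h⟩ /
        (content q v X ⟨i, by omega⟩ - content q v X ⟨i + 1, h⟩)))) • Finsupp.single X (1 : K)
        + c • Finsupp.single X' (1 : K)) X' = c := by
      simp [hXne]
    rw [hcoef] at hprod
    have hfin := (totalRep P).range.smul_mem hprod c⁻¹
    rw [← Pi.single_smul] at hfin
    have hunit : coeffOp (Finsupp.single X' (1 : K)) Y =
        c⁻¹ • coeffOp (c • Finsupp.single X' (1 : K)) Y := by
      refine LinearMap.ext fun w => ?_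
      rw [LinearMap.smul_apply, coeffOp_apply, coeffOp_apply, smul_comm (w Y), smul_smul,
        inv_mul_cancel₀ hc0, one_smul]
    rw [hunit]
    exact hfin
  · have h1 : coeffOp (Finsupp.single Y (1 : K)) Y = diagOp K lam (Pi.single Y 1) :=
      LinearMap.ext fun w => by rw [coeffOp_apply, diagOp_single_apply]
    rw [h1]
    exact hdiag Y

theorem end_eq_sum_coeffOp {lam : MultiPartition m n} (f : Module.End K (TableauSpace K lam)) :
    f = ∑ Y, ∑ X, f (Finsupp.single Y 1) X • coeffOp (Finsupp.single X (1 : K)) Y := by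
  classical
  refine Finsupp.lhom_ext' fun Z => LinearMap.ext_ring ?_
  change f (Finsupp.single Z 1) = (∑ Y, ∑ X, f (Finsupp.single Y 1) X •
    coeffOp (Finsupp.single X (1 : K)) Y) (Finsupp.single Z 1)
  rw [LinearMap.sum_apply, Finset.sum_eq_single Z]
  · rw [LinearMap.sum_apply]
    refine Finsupp.ext fun X => ?_
    simp [coeffOp_apply]
  · intro Y _ hY
    rw [LinearMap.sum_apply]
    refine Finset.sum_eq_zero fun X _ => ?_
    simp [coeffOp_apply, hY.symm]
  · simp

theorem totalRep_surjective (P : SemisimpleParameters q v n) :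
    Function.Surjective (totalRep P) := by
  classical
  rw [← AlgHom.range_eq_top, Algebra.eq_top_iff]
  intro f
  have h1 : f = ∑ lam, Pi.single lam (f lam) := (Finset.univ_sum_single f).symm
  rw [h1]
  refine Subalgebra.sum_mem _ fun lam _ => ?_
  rw [end_eq_sum_coeffOp (f lam)]
  have h2 : ∀ g : Module.End K (TableauSpace K lam), (Pi.single lam g :
      (lam : MultiPartition m n) → Module.End K (TableauSpace K lam)) =
      LinearMap.single K (fun lam => Module.End K (TableauSpace K lam)) lam g := fun _ => rfl
  rw [h2]
  simp only [map_sum, map_smul]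
  refine Subalgebra.sum_mem _ fun Y _ => Subalgebra.sum_mem _ fun X _ =>
    Subalgebra.smul_mem _ ?_ _
  exact matrixUnit_mem_range P X Y

end Surjectivity

/-! ### Generic parameters -/

section Generic

variable {K : Type*} [Field K] [Algebra ℂ K] {m : ℕ} {q : K} {v : Fin m → K}

theorem GenericParameters.semisimple (G : GenericParameters q v) (n : ℕ) :
    SemisimpleParameters q v n := by
  have hq : Transcendental ℂ q := AlgebraicIndependent.transcendental G none
  -- Inequalities in q alone can be tested by specialising q: below at 0 for q² - 1 and at 1 for the
  -- geometric sums.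
  have hpoly : ∀ p : Polynomial ℂ, ∀ x : ℂ, p.eval x ≠ 0 → Polynomial.aeval q p ≠ 0 := by
    intro p x hp h0
    refine hp ?_
    rw [transcendental_iff.1 hq p h0, Polynomial.eval_zero]
  have hq0 : q ≠ 0 := AlgebraicIndependent.ne_zero G none
  have hsep : ∀ (N : ℕ) (j k : Fin m), j ≠ k → q ^ N * v j ≠ v k := by
    intro N j k hjk h
    have h0 := algebraicIndependent_iff.1 G
      (MvPolynomial.X none ^ N * MvPolynomial.X (some j) - MvPolynomial.X (some k))
      (by simp [h])
    -- Specialising v_k to 1 and every other variable to 0 leaves -1.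
    have h1 := congrArg (MvPolynomial.eval
      fun o : Option (Fin m) => if o = some k then (1 : ℂ) else 0) h0
    simp [hjk] at h1
  refine ⟨hq0, fun _ h => ?_, fun N _ => ?_, fun i j k hjk _ _ h => ?_, fun j => ?_⟩
  · exact hpoly (Polynomial.X ^ 2 - 1) 0 (by simp) (by simp [h])
  · have := hpoly (∑ i ∈ Finset.range (N + 1), Polynomial.X ^ (2 * i)) 1
      (by simpa [Polynomial.eval_finsetSum] using Nat.cast_add_one_ne_zero N)
    simpa using this
  · have h := sub_eq_zero.1 h
    rcases le_total 0 i with hi | hi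
    · obtain ⟨N, rfl⟩ := Int.eq_ofNat_of_zero_le hi
      refine hsep (2 * N) j k hjk ?_
      rw [← h, ← zpow_natCast]
      push_cast
      rfl
    · obtain ⟨N, hN⟩ := Int.eq_ofNat_of_zero_le (neg_nonneg.2 hi)
      refine hsep (2 * N) k j hjk.symm ?_
      rw [← h, ← mul_assoc, ← zpow_natCast, ← zpow_add₀ hq0]
      have : ((2 * N : ℕ) : ℤ) + 2 * i = 0 := by push_cast; omega
      rw [this, zpow_zero, one_mul]
  · exact AlgebraicIndependent.ne_zero G (some j)

end Generic

/-! ### Dimensions and irreducible representations -/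

section Main

variable {K : Type*} [Field K] {m n : ℕ} {q : K} {v : Fin m → K}

theorem finrank_pi_end (K : Type*) [Field K] (m n : ℕ) :
    Module.finrank K ((lam : MultiPartition m n) → Module.End K (TableauSpace K lam)) =
      ∑ lam : MultiPartition m n, Fintype.card (StandardTableau lam) ^ 2 := by
  rw [Module.finrank_pi_fintype]
  refine Finset.sum_congr rfl fun lam _ => ?_
  rw [Module.finrank_linearMap, Module.finrank_finsupp_self, sq]

theorem finrank_asModule (P : SemisimpleParameters q v n) (lam : MultiPartition m n) :
    Module.finrank K (AsModule (tableauRep P lam)) = Fintype.card (StandardTableau lam) :=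
  Module.finrank_finsupp_self K

/-- The squeeze Σ (dim V_λ)² ≤ dim H ≤ n! mⁿ ≤ Σ (dim V_λ)². -/
theorem finrank_eq_sum_and (P : SemisimpleParameters q v n) :
    ∑ lam : MultiPartition m n, Fintype.card (StandardTableau lam) ^ 2 =
      Module.finrank K (HeckeAlgebra q v n) ∧
    Module.finrank K (HeckeAlgebra q v n) = n.factorial * m ^ n := by
  obtain ⟨hfin, hle⟩ := finite_and_finrank_le q v n
  have h1 := LinearMap.finrank_le_finrank_of_surjective
    (f := (totalRep P).toLinearMap) (totalRep_surjective P)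
  rw [finrank_pi_end] at h1
  have h2 := factorial_mul_pow_le_sum_card_sq m n
  omega

theorem totalRep_bijective (P : SemisimpleParameters q v n) :
    Function.Bijective (totalRep P) := by
  have hfin := (finite_and_finrank_le q v n).1
  have hs := totalRep_surjective P
  have hdim : Module.finrank K (HeckeAlgebra q v n) = Module.finrank K
      ((lam : MultiPartition m n) → Module.End K (TableauSpace K lam)) := by
    rw [finrank_pi_end, (finrank_eq_sum_and P).1]
  have hi : Function.Injective (totalRep P).toLinearMap :=
    (LinearMap.injective_iff_surjective_of_finrank_eq_finrank (V := HeckeAlgebra q v n)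
      (V₂ := (lam : MultiPartition m n) → Module.End K (TableauSpace K lam)) hdim
      (f := (totalRep P).toLinearMap)).2 hs
  exact ⟨hi, hs⟩

/-- The Hecke algebra is isomorphic to a product of matrix algebras. -/
noncomputable def totalEquiv (P : SemisimpleParameters q v n) :
    HeckeAlgebra q v n ≃ₐ[K]
      ((lam : MultiPartition m n) → Module.End K (TableauSpace K lam)) :=
  AlgEquiv.ofBijective (totalRep P) (totalRep_bijective P)

theorem isSemisimpleRing (P : SemisimpleParameters q v n) :
    IsSemisimpleRing (HeckeAlgebra q v n) := by
  have : ∀ lam : MultiPartition m n, IsSemisimpleRing (Module.End K (TableauSpace K lam)) :=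
    fun lam => IsSemisimpleRing.moduleEnd K _
  exact RingEquiv.isSemisimpleRing
    (R := (lam : MultiPartition m n) → Module.End K (TableauSpace K lam))
    (totalEquiv P).symm.toRingEquiv

theorem smul_asModule {A V : Type*} [Ring A] [Algebra K A] [AddCommGroup V] [Module K V]
    (ρ : A →ₐ[K] Module.End K V) (a : A) (x : AsModule ρ) : a • x = (ρ a : V →ₗ[K] V) x := rfl

open Classical in
/-- The element of the Hecke algebra which acts on `V_lam` by `f` and by zero on the other
representations. -/
noncomputable def blockElement (P : SemisimpleParameters q v n) (lam : MultiPartition m n)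
    (f : Module.End K (TableauSpace K lam)) : HeckeAlgebra q v n :=
  (totalEquiv P).symm (Pi.single lam f)

theorem totalRep_blockElement (P : SemisimpleParameters q v n) (lam : MultiPartition m n)
    (f : Module.End K (TableauSpace K lam)) :
    open Classical in totalRep P (blockElement P lam f) = Pi.single lam f :=
  (totalEquiv P).apply_symm_apply _

theorem tableauRep_blockElement (P : SemisimpleParameters q v n) (lam : MultiPartition m n)
    (f : Module.End K (TableauSpace K lam)) :
    tableauRep P lam (blockElement P lam f) = f := by
  classical
  rw [← totalRep_apply, totalRep_blockElement, Pi.single_eq_same]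

theorem tableauRep_blockElement_of_ne (P : SemisimpleParameters q v n)
    {lam mu : MultiPartition m n} (h : mu ≠ lam) (f : Module.End K (TableauSpace K lam)) :
    tableauRep P mu (blockElement P lam f) = 0 := by
  classical
  rw [← totalRep_apply, totalRep_blockElement, Pi.single_eq_of_ne h]

theorem mul_blockElement (P : SemisimpleParameters q v n) (lam : MultiPartition m n)
    (x : HeckeAlgebra q v n) (f : Module.End K (TableauSpace K lam)) :
    x * blockElement P lam f = blockElement P lam (tableauRep P lam x * f) := by
  apply (totalRep_bijective P).1
  rw [map_mul, totalRep_blockElement, totalRep_blockElement, mul_pi_single, totalRep_apply]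

theorem blockElement_add (P : SemisimpleParameters q v n) (lam : MultiPartition m n)
    (f g : Module.End K (TableauSpace K lam)) :
    blockElement P lam (f + g) = blockElement P lam f + blockElement P lam g := by
  classical
  apply (totalRep_bijective P).1
  rw [map_add, totalRep_blockElement, totalRep_blockElement, totalRep_blockElement,
    Pi.single_add]

instance (P : SemisimpleParameters q v n) (lam : MultiPartition m n) :
    Nontrivial (AsModule (tableauRep P lam)) :=
  inferInstanceAs (Nontrivial (StandardTableau lam →₀ K))

/-- H acts through all of End V_λ, so a rank one operator can send a nonzero vector anywhere. -/
theorem exists_tableauRep_apply_eq (P : SemisimpleParameters q v n) {lam : MultiPartition m n}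
    {x : TableauSpace K lam} (hx : x ≠ 0) (w : TableauSpace K lam) :
    ∃ a, tableauRep P lam a x = w := by
  obtain ⟨X, hX⟩ : ∃ X, x X ≠ 0 := by
    by_contra! h
    exact hx (Finsupp.ext h)
  refine ⟨blockElement P lam ((x X)⁻¹ • coeffOp w X), ?_⟩
  rw [tableauRep_blockElement, LinearMap.smul_apply, coeffOp_apply, smul_smul,
    inv_mul_cancel₀ hX, one_smul]

instance isSimpleModule (P : SemisimpleParameters q v n) (lam : MultiPartition m n) :
    IsSimpleModule (HeckeAlgebra q v n) (AsModule (tableauRep P lam)) :=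
  isSimpleModule_iff_toSpanSingleton_surjective.2
    ⟨inferInstance, fun _ hx w => exists_tableauRep_apply_eq P hx w⟩

/-- The central idempotent of the block of `lam` acts as 1 on one module and as 0 on the other. -/
theorem isEmpty_linearEquiv (P : SemisimpleParameters q v n) {lam mu : MultiPartition m n}
    (h : lam ≠ mu) : IsEmpty (AsModule (tableauRep P lam) ≃ₗ[HeckeAlgebra q v n]
      AsModule (tableauRep P mu)) := by
  refine ⟨fun φ => ?_⟩
  obtain ⟨x, hx⟩ := exists_ne (0 : AsModule (tableauRep P lam))
  refine hx (φ.injective ?_)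
  have h1 : blockElement P lam 1 • x = x := by
    rw [smul_asModule, tableauRep_blockElement]; rfl
  rw [← h1, map_smul, smul_asModule, tableauRep_blockElement_of_ne P h.symm, map_zero]
  rfl

/-- The homomorphism from `V_lam` to a module given by a vector of the module and a tableau. -/
noncomputable def homOfVector (P : SemisimpleParameters q v n) {lam : MultiPartition m n}
    (X : StandardTableau lam) {M : Type*} [AddCommGroup M] [Module (HeckeAlgebra q v n) M]
    (z : M) : AsModule (tableauRep P lam) →ₗ[HeckeAlgebra q v n] M where
  -- The matrices supported in column X form a copy of V_λ inside H as a left module; they are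
  -- applied to z.
  toFun w := blockElement P lam (coeffOp (show TableauSpace K lam from w) X) • z
  map_add' w w' := by
    rw [← add_smul, ← blockElement_add]
    congr 2
    exact LinearMap.ext fun u => smul_add _ _ _
  map_smul' x w := by
    rw [RingHom.id_apply, ← mul_smul, mul_blockElement, mul_coeffOp]
    rfl

theorem sum_blockElement (P : SemisimpleParameters q v n) :
    ∑ lam : MultiPartition m n, ∑ X : StandardTableau lam,
      blockElement P lam (coeffOp (Finsupp.single X 1) X) = 1 := by
  classical
  apply (totalRep_bijective P).1
  simp only [map_sum, totalRep_blockElement, map_one]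
  funext mu
  rw [Finset.sum_apply, Finset.sum_eq_single mu]
  · simp only [Finset.sum_apply, Pi.single_eq_same, Pi.one_apply]
    refine Finsupp.lhom_ext' fun Z => LinearMap.ext_ring ?_
    change (∑ X : StandardTableau mu, coeffOp (Finsupp.single X 1) X) (Finsupp.single Z 1) =
      Finsupp.single Z (1 : K)
    rw [LinearMap.sum_apply, Finset.sum_eq_single Z]
    · simp [coeffOp_apply]
    · intro Y _ hY
      simp [coeffOp_apply, hY.symm]
    · simp
  · intro lam _ hlam
    simp [Pi.single_eq_of_ne hlam.symm]
  · simp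

/-- The diagonal matrix units sum to 1, so one of them does not kill a given z ≠ 0. The resulting
nonzero map from V_λ to M is an isomorphism by Schur's lemma. -/
theorem exists_linearEquiv (P : SemisimpleParameters q v n) (M : Type*) [AddCommGroup M]
    [Module (HeckeAlgebra q v n) M] (hM : IsSimpleModule (HeckeAlgebra q v n) M) :
    ∃ lam, Nonempty (M ≃ₗ[HeckeAlgebra q v n] AsModule (tableauRep P lam)) := by
  have := hM.nontrivial
  obtain ⟨z, hz⟩ := exists_ne (0 : M)
  obtain ⟨lam, X, hX⟩ : ∃ (lam : MultiPartition m n) (X : StandardTableau lam),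
      blockElement P lam (coeffOp (Finsupp.single X 1) X) • z ≠ 0 := by
    by_contra! h
    apply hz
    rw [← one_smul (HeckeAlgebra q v n) z, ← sum_blockElement P, Finset.sum_smul]
    refine Finset.sum_eq_zero fun lam _ => ?_
    rw [Finset.sum_smul]
    exact Finset.sum_eq_zero fun X _ => h lam X
  have hne : homOfVector P X z ≠ 0 := fun h0 => hX (LinearMap.congr_fun h0
    (show AsModule (tableauRep P lam) from (Finsupp.single X 1 : TableauSpace K lam)))
  exact ⟨lam, ⟨(LinearEquiv.ofBijective _ (LinearMap.bijective_of_ne_zero hne)).symm⟩⟩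

end Main

end CyclotomicHecke

theorem mainTheorem1 {K : Type*} [Field K] [Algebra ℂ K] (m n : ℕ)
    (q : K) (v : Fin m → K)
    (hqv : SemisimpleParameters q v n ∨ GenericParameters q v) :
    ∃ ρ : (lam : MultiPartition m n) →
        (HeckeAlgebra q v n →ₐ[K] Module.End K (TableauSpace K lam)),
      -- the `ρ lam` are the representations given by the formulas on standard tableaux
      (∀ lam, (∀ h : 0 < n, ρ lam (tau q v h) = tauOp q v lam h) ∧
        (∀ (i : ℕ) (h : i + 1 < n), ρ lam (sigma q v i h) = sigmaOp q v lam i h)) ∧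
      -- the denominators in these formulas do not vanish
      (∀ (lam : MultiPartition m n) (X : StandardTableau lam) (i : ℕ) (h : i + 1 < n),
        content q v X ⟨i, Nat.lt_of_succ_lt h⟩ ≠ content q v X ⟨i + 1, h⟩) ∧
      -- they are irreducible
      (∀ lam, IsSimpleModule (HeckeAlgebra q v n) (AsModule (ρ lam))) ∧
      -- and pairwise non-isomorphic
      (∀ lam mu, lam ≠ mu →
        IsEmpty (AsModule (ρ lam) ≃ₗ[HeckeAlgebra q v n] AsModule (ρ mu))) ∧
      -- the sum of the squares of the dimensions is `dim H(m,1,n) = n! mⁿ`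
      Module.Finite K (HeckeAlgebra q v n) ∧
      (∑ lam : MultiPartition m n, Module.finrank K (AsModule (ρ lam)) ^ 2 =
        Module.finrank K (HeckeAlgebra q v n)) ∧
      Module.finrank K (HeckeAlgebra q v n) = n.factorial * m ^ n ∧
      -- every irreducible representation is one of them
      (∀ (M : Type*) [AddCommGroup M] [Module (HeckeAlgebra q v n) M],
        IsSimpleModule (HeckeAlgebra q v n) M →
          ∃ lam, Nonempty (M ≃ₗ[HeckeAlgebra q v n] AsModule (ρ lam))) ∧
      -- and `H(m,1,n)` is semisimple
      IsSemisimpleRing (HeckeAlgebra q v n) := by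
  have P : SemisimpleParameters q v n := hqv.elim id fun G => G.semisimple n
  refine ⟨tableauRep P, fun lam => ⟨tableauRep_tau P lam, fun i h => tableauRep_sigma P lam h⟩,
    fun lam X i h => X.content_ne P (by simp [Fin.lt_def]) (by simp), isSimpleModule P,
    fun lam mu h => isEmpty_linearEquiv P h, (finite_and_finrank_le q v n).1, ?_,
    (finrank_eq_sum_and P).2, fun M _ _ hM => exists_linearEquiv P M hM, isSemisimpleRing P⟩
  rw [← (finrank_eq_sum_and P).1]
  exact Finset.sum_congr rfl fun lam _ => by rw [finrank_asModule]
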